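/- A *host* $H=(\Sigma_H,V_H,E_H)$ consists of finite sets $\Sigma_H$ (symbols) and $V_H$ (nodes) and a set of edges $E_H\subseteq V_H\times\Sigma_H\times V_H$; $\mathrm{out}(x)$ denotes the set of edges with source $x$, and $\mathrm{Path}(x,y)$ the set of nonempty sequences of consecutive edges leading from $x$ to $y$. A *guest* $G=(\Sigma_G,V_G,E_G,M,U,I,C)$ is such a graph with sets $M,U,I\subseteq V_G$ (must, unique, exclusive nodes) and a function $C:V_G\to\mathcal P(\mathcal P(E_G))$ with $\bigcup C(u)=\mathrm{out}(u)$ for all $u$. The product $G\times H$ has alphabet $\Sigma_G\cap\Sigma_H$, nodes $V_G\times V_H$ and the edges $((u,u'),a,(v,v'))$ with $(u,a,v)\in E_G$ and $(u',a,v')\in E_H$. A *loose graph simulation* (LGS) of $G$ in $H$ is a subgraph $S=(\Sigma_G\cap\Sigma_H,V_S,E_S)$ of $G\times H$ such that 1. for every $u\in M$ there is $u'\in V_H$ with $(u,u')\in V_S$; 2. if $u\in U$ and $(u,u'),(u,v')\in V_S$, then $u'=v'$; 3. if $u\in I$ and $(u,u'),(v,u')\in V_S$, then $u=v$; 4. for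 every $(u,u')\in V_S$ there is $\gamma\in C(u)$ such that every $(u,a,v)\in\gamma$ has some $v'\in V_H$ with $((u,u'),a,(v,v'))\in E_S$; and for every $((u,u'),a,(v,v'))\in E_S$ there is such a $\gamma\in C(u)$ that contains $(u,a,v)$; 5. for all $(u,u')\in V_S$ and $v\in M$ with $\mathrm{Path}_G(u,v)\neq\emptyset$ there is $v'\in V_H$ with $\mathrm{Path}_S((u,u'),(v,v'))\ne\emptyset$. The *pruning algorithm* starts with $S=G\times H$ and repeats the following round until a round changes nothing. For each node $(u,u')$ of $S$ (in any order): first, for each edge $((u,u'),a,(v,v'))$ of $S$ going out of it (in any order), remove this edge from $S$ unless there is $\gamma\in C(u)$ with $(u,a,v)\in\gamma$ such that every $(u,b,w)\in\gamma$ has some $w'$ with $((u,u'),b,(w,w'))\in E_S$; then remove the node $(u,u')$ and all edges incident with it if $\mathrm{out}_S((u,u'))=\emptyset$ and $\emptyset\notin C(u)$, or if some $m\in M$ satisfies $\mathrm{Path}_G(u,m)\ne\emptyset$ and $\mathrm{Path}_S((u,u'),(m,v'))=\emptyset$ for all $v'\in V_H$. (All tests refer to the current $S$.) Finally it returns $S$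 if every $m\in M$ occurs in $V_S$ as $(m,v)$ for some $v\in V_H$, and *false* otherwise. **Theorem.** Let $H$ be a host and $G$ a guest with $U=I=\emptyset$. (a) If an LGS of $G$ in $H$ exists, then there is a greatest one with respect to inclusion of graphs. (b) Whatever the orders of its loops, the pruning algorithm halts after at most $|V_{G\times H}|+|E_{G\times H}|+1$ rounds; it returns the greatest LGS if an LGS exists, and *false* otherwise. (c) This is polynomial time in the size of the input $(G,H)$, in which all sets and the choice function are given by explicit lists: each round of the algorithm can be executed in polynomial time, and there is a polynomial-time program that computes from $(G,H)$ the result of the algorithm, i.e. the greatest LGS or *false*. (d) The emptiness problem (is there no LGS of $G$ in $H$?) for guests with $U=I=\emptyset$ is decidable in polynomial time. -/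

import Mathlib

namespace LooseSim

universe u v w

/-! ### Hosts, guests and loose graph simulations -/

/-- A host graph `(Σ, V, E)`: a finite alphabet, a finite set of nodes and a set
`E ⊆ V × Σ × V` of edges. An edge `e = (v, l, v')` has source `e.1`, label `e.2.1` and
target `e.2.2`. -/
@[ext]
structure HostGraph (L : Type u) (N : Type v) where
  symbols : Finset L
  nodes : Finset N
  edges : Finset (N × L × N)
  src_mem : ∀ e ∈ edges, e.1 ∈ nodes
  label_mem : ∀ e ∈ edges, e.2.1 ∈ symbols
  tgt_mem : ∀ e ∈ edges, e.2.2 ∈ nodes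

namespace HostGraph

variable {L : Type u} {N : Type v} {N' : Type w}

/-- Inclusion of graphs. -/
instance : LE (HostGraph L N) :=
  ⟨fun S T => S.symbols ⊆ T.symbols ∧ S.nodes ⊆ T.nodes ∧ S.edges ⊆ T.edges⟩

/-- The outgoing edges of a node. -/
def out [DecidableEq N] (M : HostGraph L N) (x : N) : Finset (N × L × N) :=
  M.edges.filter fun e => e.1 = x

/-- The paths from `x` to `y`: nonempty sequences of consecutive edges that start in `x` and end
in `y`. -/
def paths (M : HostGraph L N) (x y : N) : Set (List (N × L × N)) :=
  {p | (∀ e ∈ p, e ∈ M.edges) ∧ p.IsChain (fun e f => f.1 = e.2.2) ∧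
    (∃ e ∈ p.head?, e.1 = x) ∧ (∃ e ∈ p.getLast?, e.2.2 = y)}

/-- The tensor product of two graphs. -/
def prod [DecidableEq L] [DecidableEq N] [DecidableEq N'] (M₁ : HostGraph L N)
    (M₂ : HostGraph L N') : HostGraph L (N × N') where
  symbols := M₁.symbols ∩ M₂.symbols
  nodes := M₁.nodes ×ˢ M₂.nodes
  edges := ((M₁.edges ×ˢ M₂.edges).filter fun p => p.1.2.1 = p.2.2.1).image
    fun p => ((p.1.1, p.2.1), p.1.2.1, (p.1.2.2, p.2.2.2))
  src_mem := by
    intro e he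
    obtain ⟨p, hp, rfl⟩ := Finset.mem_image.1 he
    have hp := Finset.mem_product.1 (Finset.mem_filter.1 hp).1
    exact Finset.mem_product.2 ⟨M₁.src_mem _ hp.1, M₂.src_mem _ hp.2⟩
  label_mem := by
    intro e he
    obtain ⟨p, hp, rfl⟩ := Finset.mem_image.1 he
    obtain ⟨hp, h⟩ := Finset.mem_filter.1 hp
    have hp := Finset.mem_product.1 hp
    exact Finset.mem_inter.2 ⟨M₁.label_mem _ hp.1, h ▸ M₂.label_mem _ hp.2⟩
  tgt_mem := by
    intro e he
    obtain ⟨p, hp, rfl⟩ := Finset.mem_image.1 he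
    have hp := Finset.mem_product.1 (Finset.mem_filter.1 hp).1
    exact Finset.mem_product.2 ⟨M₁.tgt_mem _ hp.1, M₂.tgt_mem _ hp.2⟩

/-- Remove one edge. -/
def removeEdge [DecidableEq L] [DecidableEq N] (M : HostGraph L N) (e : N × L × N) :
    HostGraph L N where
  symbols := M.symbols
  nodes := M.nodes
  edges := M.edges.erase e
  src_mem f hf := M.src_mem f (Finset.mem_of_mem_erase hf)
  label_mem f hf := M.label_mem f (Finset.mem_of_mem_erase hf)
  tgt_mem f hf := M.tgt_mem f (Finset.mem_of_mem_erase hf)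

/-- Remove one node together with its outgoing and incoming edges. -/
def removeNode [DecidableEq N] (M : HostGraph L N) (x : N) : HostGraph L N where
  symbols := M.symbols
  nodes := M.nodes.erase x
  edges := M.edges.filter fun e => ¬ (e.1 = x ∨ e.2.2 = x)
  src_mem e he := by
    obtain ⟨he, h⟩ := Finset.mem_filter.1 he
    exact Finset.mem_erase.2 ⟨fun hx => h (Or.inl hx), M.src_mem e he⟩
  label_mem e he := M.label_mem e (Finset.mem_filter.1 he).1
  tgt_mem e he := by
    obtain ⟨he, h⟩ := Finset.mem_filter.1 he
    exact Finset.mem_erase.2 ⟨fun hx => h (Or.inr hx), M.tgt_mem e he⟩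

end HostGraph

/-- A guest `(Σ, V, E, M, U, I, C)`: a graph with a must, a unique and an exclusive set of nodes
and a choice function `C` such that `⋃ C(x) = out(x)` for every node `x`. (Values of `choice`
outside the set of nodes are irrelevant.) -/
structure Guest (L : Type u) (N : Type v) extends HostGraph L N where
  must : Finset N
  unique : Finset N
  exclusive : Finset N
  choice : N → Finset (Finset (N × L × N))
  must_subset : must ⊆ nodes
  unique_subset : unique ⊆ nodes
  exclusive_subset : exclusive ⊆ nodes
  choice_union : ∀ x ∈ nodes, ∀ e, (∃ γ ∈ choice x, e ∈ γ) ↔ (e ∈ edges ∧ e.1 = x)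

section LGS

variable {L : Type u} {N : Type v} {N' : Type w} [DecidableEq L] [DecidableEq N] [DecidableEq N']

/-- `S` is a loose graph simulation of the guest `G` in the host `H`. -/
structure IsLGS (G : Guest L N) (H : HostGraph L N') (S : HostGraph L (N × N')) : Prop where
  /-- `S` is a subgraph of `G × H`, over the alphabet `Σ_G ∩ Σ_H`. -/
  symbols_eq : S.symbols = G.symbols ∩ H.symbols
  subgraph : S ≤ G.toHostGraph.prod H
  /-- every must node occurs -/
  must_occurs : ∀ u ∈ G.must, ∃ u' ∈ H.nodes, (u, u') ∈ S.nodes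
  /-- a unique node is assigned to at most one node of the host -/
  unique_occurs : ∀ u ∈ G.unique, ∀ u' v' : N', (u, u') ∈ S.nodes → (u, v') ∈ S.nodes → u' = v'
  /-- a host node assigned to an exclusive node is assigned to no other node -/
  exclusive_occurs : ∀ u ∈ G.exclusive, ∀ (v : N) (u' : N'),
    (u, u') ∈ S.nodes → (v, u') ∈ S.nodes → u = v
  /-- at every node of `S` some choice set is realised -/
  choice_node : ∀ (u : N) (u' : N'), (u, u') ∈ S.nodes → ∃ γ ∈ G.choice u,
    ∀ (a : L) (v : N), (u, a, v) ∈ γ → ∃ v' ∈ H.nodes, ((u, u'), a, (v, v')) ∈ S.edges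
  /-- every edge of `S` belongs to a realised choice set -/
  choice_edge : ∀ (u : N) (u' : N') (a : L) (v : N) (v' : N'),
    ((u, u'), a, (v, v')) ∈ S.edges → ∃ γ ∈ G.choice u, (u, a, v) ∈ γ ∧
      ∀ (b : L) (x : N), (u, b, x) ∈ γ → ∃ x' ∈ H.nodes, ((u, u'), b, (x, x')) ∈ S.edges
  /-- connectivity with respect to must nodes is preserved -/
  must_reach : ∀ (u : N) (u' : N'), (u, u') ∈ S.nodes → ∀ v ∈ G.must,
    (G.paths u v).Nonempty → ∃ v' ∈ H.nodes, (S.paths (u, u') (v, v')).Nonempty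

/-- The set of all loose graph simulations of `G` in `H`. -/
def LGS (G : Guest L N) (H : HostGraph L N') : Set (HostGraph L (N × N')) :=
  {S | IsLGS G H S}

/-! ### The iterative pruning algorithm -/

/-- A way of enumerating finite sets, i.e. the orders in which `foreach` loops run. -/
structure Enumeration (α : Type u) where
  toList : Finset α → List α
  nodup : ∀ s, (toList s).Nodup
  mem_iff : ∀ s a, a ∈ toList s ↔ a ∈ s

/-- The edge `e = ((u, u'), a, (v, v'))` of the current graph `S` lies in a choice set of `u` all
of whose edges are matched by edges of `S` with source `(u, u')`. -/
def EdgeSupported (G : Guest L N) (H : HostGraph L N') (S : HostGraph L (N × N'))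
    (e : (N × N') × L × (N × N')) : Prop :=
  ∃ γ ∈ G.choice e.1.1, (e.1.1, e.2.1, e.2.2.1) ∈ γ ∧
    ∀ (b : L) (x : N), (e.1.1, b, x) ∈ γ →
      ∃ x' : N', (e.1.2, b, x') ∈ H.out e.1.2 ∧ (e.1, b, (x, x')) ∈ S.out e.1

/-- The test for the removal of the node `(u, u')` from the current graph `S`. -/
def NodeRefuted (G : Guest L N) (H : HostGraph L N') (S : HostGraph L (N × N'))
    (x : N × N') : Prop :=
  (S.out x = ∅ ∧ ∅ ∉ G.choice x.1) ∨
    ∃ m ∈ G.must, (G.paths x.1 m).Nonempty ∧ ∀ v' ∈ H.nodes, S.paths x (m, v') = ∅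

open scoped Classical in
/-- Inner loop: run through the outgoing edges of `x` and remove the unsupported ones. -/
noncomputable def pruneEdges (G : Guest L N) (H : HostGraph L N')
    (ordE : Enumeration ((N × N') × L × (N × N'))) (S : HostGraph L (N × N')) (x : N × N') :
    HostGraph L (N × N') :=
  (ordE.toList (S.out x)).foldl
    (fun S e => if EdgeSupported G H S e then S else S.removeEdge e) S

open scoped Classical in
/-- Remove the node `x` if it is refuted. -/
noncomputable def pruneNode (G : Guest L N) (H : HostGraph L N') (S : HostGraph L (N × N'))
    (x : N × N') : HostGraph L (N × N') :=
  if NodeRefuted G H S x then S.removeNode x else S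

/-- One execution of the body of the do-while loop: run through all nodes. -/
noncomputable def pruneRound (G : Guest L N) (H : HostGraph L N') (ordV : Enumeration (N × N'))
    (ordE : Enumeration ((N × N') × L × (N × N'))) (S : HostGraph L (N × N')) :
    HostGraph L (N × N') :=
  (ordV.toList S.nodes).foldl (fun S x => pruneNode G H (pruneEdges G H ordE S x) x) S

/-- `PruneLoop G H ordV ordE S n T`: the do-while loop, entered with the graph `S`, executes its
body `n` times and is left with the graph `T`. It stops as soon as a round changes nothing. -/
inductive PruneLoop (G : Guest L N) (H : HostGraph L N') (ordV : Enumeration (N × N'))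
    (ordE : Enumeration ((N × N') × L × (N × N'))) :
    HostGraph L (N × N') → ℕ → HostGraph L (N × N') → Prop
  | halt (S : HostGraph L (N × N'))
      (hV : (pruneRound G H ordV ordE S).nodes = S.nodes)
      (hE : (pruneRound G H ordV ordE S).edges = S.edges) :
      PruneLoop G H ordV ordE S 1 S
  | again (S T : HostGraph L (N × N')) (n : ℕ)
      (h : (pruneRound G H ordV ordE S).nodes ≠ S.nodes ∨
        (pruneRound G H ordV ordE S).edges ≠ S.edges)
      (hT : PruneLoop G H ordV ordE (pruneRound G H ordV ordE S) n T) :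
      PruneLoop G H ordV ordE S (n + 1) T

open scoped Classical in
/-- The last step: return the graph if every must node occurs in it, and `none` ("false")
otherwise. -/
noncomputable def pruneReturn (G : Guest L N) (H : HostGraph L N') (S : HostGraph L (N × N')) :
    Option (HostGraph L (N × N')) :=
  if ∀ m ∈ G.must, ∃ v ∈ H.nodes, (m, v) ∈ S.nodes then some S else none

/-- The pruning algorithm, started on `G` and `H`, halts after `n` rounds and returns `r`. -/
def PruningRun (G : Guest L N) (H : HostGraph L N') (ordV : Enumeration (N × N'))
    (ordE : Enumeration ((N × N') × L × (N × N'))) (n : ℕ)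
    (r : Option (HostGraph L (N × N'))) : Prop :=
  ∃ T, PruneLoop G H ordV ordE (G.toHostGraph.prod H) n T ∧ r = pruneReturn G H T

end LGS

/-! ### Machine model

Programs of a (variable-free) WHILE language over binary trees, the usual data type of LISP-like
models of computation. Every instruction costs the size of the data that it is applied to, so
that the cost of a run bounds the size of all data produced in it, up to a constant factor, and is
polynomially related to the running time of a Turing machine. -/

/-- Binary trees. -/
inductive Data where
  | nil : Data
  | cons : Data → Data → Data
  deriving DecidableEq

namespace Data

/-- Number of `nil`s and `cons`es. -/
def size : Data → ℕ
  | nil => 1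
  | cons a b => a.size + b.size + 1

def hd : Data → Data
  | nil => nil
  | cons a _ => a

def tl : Data → Data
  | nil => nil
  | cons _ b => b

/-- The truth values are `nil` (false) and `tt` (true). -/
def tt : Data := cons nil nil

/-- Lists of trees as trees. -/
def ofList : List Data → Data
  | [] => nil
  | d :: ds => cons d (ofList ds)

end Data

/-- Programs; each of them transforms one tree into another one. -/
inductive Prog where
  /-- return the input -/
  | id : Prog
  /-- return `nil` -/
  | nil : Prog
  /-- first component -/
  | hd : Prog
  /-- second component -/
  | tl : Prog
  /-- are both components equal? -/
  | eq : Prog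
  /-- run both programs on the input and pair the results -/
  | pair : Prog → Prog → Prog
  /-- run the first program, then the second one on its result -/
  | comp : Prog → Prog → Prog
  /-- `ite c p q`: run `p` if the result of `c` is not `nil`, and `q` otherwise -/
  | ite : Prog → Prog → Prog → Prog
  /-- `loop c p`: as long as the result of `c` is not `nil`, replace the data by the result
  of `p` -/
  | loop : Prog → Prog → Prog

/-- `Runs P x t y`: the program `P`, started on `x`, halts after `t` steps with result `y`. -/
inductive Runs : Prog → Data → ℕ → Data → Prop
  | id (x : Data) : Runs Prog.id x x.size x
  | nil (x : Data) : Runs Prog.nil x x.size Data.nil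
  | hd (x : Data) : Runs Prog.hd x x.size x.hd
  | tl (x : Data) : Runs Prog.tl x x.size x.tl
  | eq (x : Data) : Runs Prog.eq x x.size (if x.hd = x.tl then Data.tt else Data.nil)
  | pair {p q : Prog} {x a b : Data} {m n : ℕ} (hp : Runs p x m a) (hq : Runs q x n b) :
      Runs (Prog.pair p q) x (x.size + m + n) (Data.cons a b)
  | comp {p q : Prog} {x y z : Data} {m n : ℕ} (hp : Runs p x m y) (hq : Runs q y n z) :
      Runs (Prog.comp p q) x (x.size + m + n) z
  | ite_true {c p q : Prog} {x b y : Data} {m n : ℕ} (hc : Runs c x m b) (hb : b ≠ Data.nil)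
      (hp : Runs p x n y) : Runs (Prog.ite c p q) x (x.size + m + n) y
  | ite_false {c p q : Prog} {x y : Data} {m n : ℕ} (hc : Runs c x m Data.nil)
      (hq : Runs q x n y) : Runs (Prog.ite c p q) x (x.size + m + n) y
  | loop_halt {c p : Prog} {x : Data} {m : ℕ} (hc : Runs c x m Data.nil) :
      Runs (Prog.loop c p) x (x.size + m) x
  | loop_again {c p : Prog} {x b y z : Data} {m n k : ℕ} (hc : Runs c x m b)
      (hb : b ≠ Data.nil) (hp : Runs p x n y) (hl : Runs (Prog.loop c p) y k z) :
      Runs (Prog.loop c p) x (x.size + m + n + k) z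

/-- A computational problem, given by the relations "`x` is an input that represents the instance
`i`" and "`y` is a correct output for the instance `i`", is solvable in polynomial time: a single
program solves all instances, in a number of steps polynomial in the size of the input. -/
def PolyTimeSolvable {ι : Type u} (input output : ι → Data → Prop) : Prop :=
  ∃ (P : Prog) (p : Polynomial ℕ), ∀ (i : ι) (x : Data), input i x →
    ∃ (t : ℕ) (y : Data), Runs P x t y ∧ t ≤ p.eval x.size ∧ output i y

/-! ### Representation of graphs

The inputs are graphs whose nodes and symbols are names, i.e. arbitrary trees. Finite sets are
represented by lists without repetition, in any order. -/

/-- `d` lists the elements of `s`, in some order and without repetition, where `R a c` means that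
`c` represents the element `a`. -/
def IsListing {α : Type u} (R : α → Data → Prop) (s : Finset α) (d : Data) : Prop :=
  ∃ (l : List α) (ds : List Data), l.Nodup ∧ (∀ a, a ∈ l ↔ a ∈ s) ∧ List.Forall₂ R l ds ∧
    d = Data.ofList ds

/-- Edges are represented by triples; `nm` is the representation of nodes. -/
def edgeCode {N : Type u} (nm : N → Data) (e : N × Data × N) : Data :=
  Data.cons (nm e.1) (Data.cons e.2.1 (nm e.2.2))

/-- `d` represents the graph `M`, by lists of its symbols, nodes and edges. -/
def IsGraphCode {N : Type u} (nm : N → Data) (M : HostGraph Data N) (d : Data) : Prop :=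
  ∃ dS dV dE : Data, d = Data.cons dS (Data.cons dV dE) ∧
    IsListing (fun a c => c = a) M.symbols dS ∧
    IsListing (fun x c => c = nm x) M.nodes dV ∧
    IsListing (fun e c => c = edgeCode nm e) M.edges dE

/-- `d` represents the guest `G`: the underlying graph, lists of the must, unique and exclusive
nodes, and a list of all pairs of a node and (a list of) its choice sets. -/
def IsGuestCode (G : Guest Data Data) (d : Data) : Prop :=
  ∃ dG dM dU dI dC : Data,
    d = Data.cons dG (Data.cons dM (Data.cons dU (Data.cons dI dC))) ∧
    IsGraphCode (fun x => x) G.toHostGraph dG ∧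
    IsListing (fun x c => c = x) G.must dM ∧
    IsListing (fun x c => c = x) G.unique dU ∧
    IsListing (fun x c => c = x) G.exclusive dI ∧
    IsListing (fun x c => ∃ k, c = Data.cons x k ∧
      IsListing (IsListing fun e c => c = edgeCode (fun x => x) e) (G.choice x) k) G.nodes dC

/-- `d` represents the pair of a guest and a host. -/
def IsInputCode (i : Guest Data Data × HostGraph Data Data) (d : Data) : Prop :=
  ∃ dG dH : Data, d = Data.cons dG dH ∧ IsGuestCode i.1 dG ∧ IsGraphCode (fun x => x) i.2 dH

/-- `d` represents the result of the algorithm: a subgraph of the product, or false (`nil`). -/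
def IsResultCode : Option (HostGraph Data (Data × Data)) → Data → Prop
  | none, d => d = Data.nil
  | some S, d => IsGraphCode (fun x => Data.cons x.1 x.2) S d

/-- The inputs of the fragment: guests whose unique and exclusive sets are empty, and hosts. -/
def IsFragmentInput (i : Guest Data Data × HostGraph Data Data) (d : Data) : Prop :=
  i.1.unique = ∅ ∧ i.1.exclusive = ∅ ∧ IsInputCode i d

/-- The inputs of one round of the algorithm: an input of the fragment and a subgraph of the
product. -/
def IsRoundInput
    (i : (Guest Data Data × HostGraph Data Data) × HostGraph Data (Data × Data)) (d : Data) :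
    Prop :=
  i.2 ≤ i.1.1.toHostGraph.prod i.1.2 ∧ ∃ dI dS : Data, d = Data.cons dI dS ∧
    IsFragmentInput i.1 dI ∧ IsResultCode (some i.2) dS

end LooseSim

open LooseSim

/-! A removal never hurts a simulation. If an LGS `T` lies in the current graph `S`, its realised
choice sets and its paths are also present in `S`, so no edge or node of `T` can fail a test
(`IsLGS.edgeSupported`, `IsLGS.not_nodeRefuted`). Hence every graph met by the algorithm, starting
with the product, contains all simulations, whatever the loop orders. Since steps only delete, a
round without net change has deleted nothing at all, so every test passes on its graph
(`pruneRound_eq_self_iff`). For `U = I = ∅` such a graph satisfies all conditions on an LGS except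
the occurrence of must nodes (`IsUpperApprox.isLGS`). If the must nodes occur, it is the greatest
LGS; if one is missing, it is missing from every LGS, and there is none. Every other round lowers
the number of nodes and edges, which bounds the number of rounds.

For the complexity claims, `Poly` is shown to be closed under the usual list operations. The central
closure property is `Poly.foldl`: a fold is polynomial provided that its accumulator stays
polynomially bounded, and here the accumulators are mostly lists that only shrink. The algorithm is
rewritten on lists, with reachability computed by iterated filtering, and each list round is matched
with a round of the abstract algorithm whose orders are read off from the lists
(`lists_pruneRoundList`). The list program does not test for a change but runs `|V| + |E|` rounds,
after which the graph is stable (`PruneRounds.isStable`). The orders may differ from round to round;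
this does no harm, because the result is characterised independently of them
(`IsPruningResult.unique`). -/

namespace LooseSim

/-! ### Polynomial-time functions between encoded types -/

theorem eval_mono_nat (p : Polynomial ℕ) {m n : ℕ} (h : m ≤ n) : p.eval m ≤ p.eval n := by
  rw [Polynomial.eval_eq_sum, Polynomial.eval_eq_sum]
  exact Finset.sum_le_sum fun i _ => Nat.mul_le_mul_left _ (Nat.pow_le_pow_left h i)

namespace Data

theorem size_pos (x : Data) : 1 ≤ x.size := by cases x <;> simp [size]

theorem size_hd_le (x : Data) : x.hd.size ≤ x.size := by
  cases x <;> simp [size, hd]; omega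

theorem size_tl_le (x : Data) : x.tl.size ≤ x.size := by
  cases x <;> simp [size, tl]; omega

end Data

/-- The size of a result is linear in the number of steps. -/
theorem Runs.size_le {P : Prog} {x y : Data} {t : ℕ} (h : Runs P x t y) : y.size ≤ 3 * t := by
  induction h with
  | id x => omega
  | nil x => have := x.size_pos; simp only [Data.size]; omega
  | hd x => have := x.size_hd_le; omega
  | tl x => have := x.size_tl_le; omega
  -- The factor 3 is attained here: on `nil` the test costs 1 and returns `tt`, of size 3.
  | eq x =>
    have := x.size_pos
    split_ifs <;> simp only [Data.tt, Data.size] <;> omega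
  | @pair _ _ x _ _ _ _ _ _ ih₁ ih₂ => have := x.size_pos; simp only [Data.size]; omega
  | comp _ _ _ ih => omega
  | ite_true _ _ _ _ ih => omega
  | ite_false _ _ _ ih => omega
  | loop_halt _ => omega
  | loop_again _ _ _ _ _ _ ih => omega

/-- The program `P`, started on `x`, halts within `b` steps with result `y`. -/
def RunsIn (P : Prog) (x : Data) (b : ℕ) (y : Data) : Prop :=
  ∃ t, Runs P x t y ∧ t ≤ b

namespace RunsIn

variable {P Q R : Prog} {x y z : Data} {m n k : ℕ}

theorem mono (h : RunsIn P x m y) (hmn : m ≤ n) : RunsIn P x n y :=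
  let ⟨t, ht, hb⟩ := h; ⟨t, ht, hb.trans hmn⟩

theorem size_le (h : RunsIn P x m y) : y.size ≤ 3 * m := by
  obtain ⟨t, ht, hb⟩ := h
  have := ht.size_le
  omega

theorem id : RunsIn Prog.id x x.size x := ⟨_, .id x, le_rfl⟩

theorem hd : RunsIn Prog.hd x x.size x.hd := ⟨_, .hd x, le_rfl⟩

theorem tl : RunsIn Prog.tl x x.size x.tl := ⟨_, .tl x, le_rfl⟩

theorem pair (hP : RunsIn P x m y) (hQ : RunsIn Q x n z) :
    RunsIn (.pair P Q) x (x.size + m + n) (.cons y z) := by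
  obtain ⟨s, hs, hsm⟩ := hP
  obtain ⟨t, ht, htn⟩ := hQ
  exact ⟨_, .pair hs ht, by omega⟩

theorem comp (hP : RunsIn P x m y) (hQ : RunsIn Q y n z) :
    RunsIn (.comp P Q) x (x.size + m + n) z := by
  obtain ⟨s, hs, hsm⟩ := hP
  obtain ⟨t, ht, htn⟩ := hQ
  exact ⟨_, .comp hs ht, by omega⟩

theorem ite_true (hP : RunsIn P x m y) (hy : y ≠ .nil) (hQ : RunsIn Q x n z) :
    RunsIn (.ite P Q R) x (x.size + m + n) z := by
  obtain ⟨s, hs, hsm⟩ := hP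
  obtain ⟨t, ht, htn⟩ := hQ
  exact ⟨_, .ite_true hs hy ht, by omega⟩

theorem ite_false (hP : RunsIn P x m .nil) (hR : RunsIn R x n z) :
    RunsIn (.ite P Q R) x (x.size + m + n) z := by
  obtain ⟨s, hs, hsm⟩ := hP
  obtain ⟨t, ht, htn⟩ := hR
  exact ⟨_, .ite_false hs ht, by omega⟩

theorem loop_halt (hP : RunsIn P x m .nil) : RunsIn (.loop P Q) x (x.size + m) x := by
  obtain ⟨s, hs, hsm⟩ := hP
  exact ⟨_, .loop_halt hs, by omega⟩

theorem loop_again {w : Data} (hP : RunsIn P x m w) (hw : w ≠ .nil) (hQ : RunsIn Q x n y)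
    (hl : RunsIn (.loop P Q) y k z) : RunsIn (.loop P Q) x (x.size + m + n + k) z := by
  obtain ⟨r, hr, hrm⟩ := hP
  obtain ⟨s, hs, hsn⟩ := hQ
  obtain ⟨t, ht, htk⟩ := hl
  exact ⟨_, .loop_again hr hw hs ht, by omega⟩

end RunsIn

/-- Types whose elements are encoded by trees. -/
class Enc (α : Type) where
  enc : α → Data
  enc_injective : Function.Injective enc

open Enc

instance : Enc Data := ⟨fun x => x, fun _ _ h => h⟩

instance : Enc Bool := ⟨fun b => bif b then Data.tt else Data.nil, by
  intro a b h
  cases a <;> cases b <;> simp [Data.tt] at h ⊢⟩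

instance {α β : Type} [Enc α] [Enc β] : Enc (α × β) := ⟨fun a => .cons (enc a.1) (enc a.2), by
  intro a b h
  simp only [Data.cons.injEq] at h
  exact Prod.ext (enc_injective h.1) (enc_injective h.2)⟩

theorem Data.ofList_injective : Function.Injective Data.ofList := by
  intro a
  induction a with
  | nil => intro b h; cases b <;> simp_all [Data.ofList]
  | cons x a ih =>
    intro b h
    cases b with
    | nil => simp [Data.ofList] at h
    | cons y b =>
      simp only [Data.ofList, Data.cons.injEq] at h
      rw [h.1, ih h.2]

instance {α : Type} [Enc α] : Enc (List α) := ⟨fun l => Data.ofList (l.map enc),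
  Data.ofList_injective.comp (List.map_injective_iff.2 enc_injective)⟩

/-! ### Sizes of encoded lists -/

section Size

variable {α β : Type} [Enc α] [Enc β]

/-- The size of the encoding. -/
def esize (a : α) : ℕ := (enc a).size

theorem enc_pair (a : α) (b : β) : enc (a, b) = .cons (enc a) (enc b) := rfl

theorem enc_nil : enc ([] : List α) = .nil := rfl

theorem enc_cons (a : α) (l : List α) : enc (a :: l) = .cons (enc a) (enc l) := rfl

theorem esize_pos (a : α) : 1 ≤ esize a := (enc a).size_pos

theorem esize_pair (a : α) (b : β) : esize (a, b) = esize a + esize b + 1 := rfl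

theorem esize_nil : esize ([] : List α) = 1 := rfl

theorem esize_cons (a : α) (l : List α) : esize (a :: l) = esize a + esize l + 1 := rfl

theorem esize_bool (b : Bool) : esize b ≤ 3 := by cases b <;> decide

/-- The final `nil` of `k` disappears in the concatenation. -/
theorem esize_append (k l : List α) : esize (k ++ l) + 1 = esize k + esize l := by
  induction k with
  | nil => rw [List.nil_append, esize_nil]; omega
  | cons a k ih => rw [List.cons_append, esize_cons, esize_cons]; omega

theorem esize_le_of_sublist {k l : List α} (h : k.Sublist l) : esize k ≤ esize l := by
  induction h with
  | slnil => exact le_rfl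
  | cons a _ ih => rw [esize_cons]; omega
  | cons_cons a _ ih => rw [esize_cons, esize_cons]; omega

theorem esize_filter_le (p : α → Bool) (l : List α) : esize (l.filter p) ≤ esize l :=
  esize_le_of_sublist List.filter_sublist

theorem length_lt_esize (l : List α) : l.length < esize l := by
  induction l with
  | nil => rw [esize_nil]; simp
  | cons a l ih => rw [esize_cons, List.length_cons]; omega

theorem esize_lt_of_mem {a : α} {l : List α} (h : a ∈ l) : esize a < esize l := by
  induction l with
  | nil => simp at h
  | cons b l ih =>
    rw [esize_cons]
    rcases List.mem_cons.1 h with rfl | h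
    · omega
    · have := ih h
      omega

theorem esize_reverse (l : List α) : esize l.reverse = esize l := by
  induction l with
  | nil => rfl
  | cons a l ih =>
    have := esize_append l.reverse [a]
    rw [esize_cons, esize_nil] at this
    rw [List.reverse_cons, esize_cons]
    omega

theorem esize_flatten_le (l : List (List α)) : esize l.flatten ≤ esize l := by
  induction l with
  | nil => exact le_rfl
  | cons a l ih =>
    have := esize_append a l.flatten
    rw [List.flatten_cons, esize_cons]
    omega

theorem esize_map_le {α : Type} (f : α → β) {b : ℕ} {l : List α} (h : ∀ a ∈ l, esize (f a) ≤ b) :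
    esize (l.map f) ≤ l.length * (b + 1) + 1 := by
  induction l with
  | nil => simp [esize_nil]
  | cons a l ih =>
    have h₁ := ih fun a ha => h a (List.mem_cons_of_mem _ ha)
    have h₂ := h a List.mem_cons_self
    rw [List.map_cons, esize_cons, List.length_cons, Nat.succ_mul]
    omega

end Size

/-- `f` is computed by a program in polynomial time. -/
@[fun_prop]
def Poly {α β : Type} [Enc α] [Enc β] (f : α → β) : Prop :=
  ∃ (P : Prog) (p : Polynomial ℕ), ∀ a, RunsIn P (enc a) (p.eval (esize a)) (enc (f a))

/-! ### Closure properties of polynomial-time functions -/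

namespace Poly

variable {α β γ : Type} [Enc α] [Enc β] [Enc γ]

open Polynomial in
@[fun_prop]
theorem id : Poly (fun a : α => a) :=
  ⟨.id, X, fun a => RunsIn.id.mono (by simp [esize])⟩

-- The second program runs on data whose size is at most three times the time spent by the first
-- one; hence the inner argument `C 3 * p`.
open Polynomial in
@[fun_prop]
theorem comp {g : β → γ} {f : α → β} (hg : Poly g) (hf : Poly f) : Poly (fun a => g (f a)) := by
  obtain ⟨P, p, hP⟩ := hf
  obtain ⟨Q, q, hQ⟩ := hg
  refine ⟨.comp P Q, X + p + q.comp (C 3 * p), fun a => ((hP a).comp (hQ (f a))).mono ?_⟩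
  have := eval_mono_nat q (hP a).size_le
  simp only [eval_add, eval_X, eval_comp, eval_mul, eval_C]
  change esize a + _ + q.eval (enc (f a)).size ≤ _
  omega

open Polynomial in
theorem const_data (d : Data) : Poly (fun _ : α => d) := by
  induction d with
  | nil => exact ⟨.nil, X, fun a => ⟨_, .nil _, by simp [esize]⟩⟩
  | cons d e hd he =>
    obtain ⟨P, p, hP⟩ := hd
    obtain ⟨Q, q, hQ⟩ := he
    refine ⟨.pair P Q, X + p + q, fun a => ((hP a).pair (hQ a)).mono ?_⟩
    simp [esize]

@[fun_prop]
theorem const (b : β) : Poly (fun _ : α => b) :=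
  const_data (α := α) (enc b)

open Polynomial in
@[fun_prop]
theorem fst {f : α → β × γ} (hf : Poly f) : Poly (fun a => (f a).1) :=
  comp (g := Prod.fst) ⟨.hd, X, fun a => RunsIn.hd.mono (by simp [esize])⟩ hf

open Polynomial in
@[fun_prop]
theorem snd {f : α → β × γ} (hf : Poly f) : Poly (fun a => (f a).2) :=
  comp (g := Prod.snd) ⟨.tl, X, fun a => RunsIn.tl.mono (by simp [esize])⟩ hf

open Polynomial in
@[fun_prop]
theorem prodMk {f : α → β} {g : α → γ} (hf : Poly f) (hg : Poly g) :
    Poly (fun a => (f a, g a)) := by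
  obtain ⟨P, p, hP⟩ := hf
  obtain ⟨Q, q, hQ⟩ := hg
  refine ⟨.pair P Q, X + p + q, fun a => ((hP a).pair (hQ a)).mono ?_⟩
  simp [esize]

/-- The size of the values is polynomially bounded. -/
theorem exists_esize_le {f : α → β} (hf : Poly f) :
    ∃ p : Polynomial ℕ, ∀ a, esize (f a) ≤ p.eval (esize a) := by
  obtain ⟨P, p, hP⟩ := hf
  refine ⟨.C 3 * p, fun a => ?_⟩
  simpa [esize] using (hP a).size_le

theorem toData {f : α → β} (hf : Poly f) : Poly (fun a => enc (f a)) := hf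

-- The code of `a :: l` is by definition the code of the pair `(a, l)`.
@[fun_prop]
theorem listCons {f : α → β} {g : α → List β} (hf : Poly f) (hg : Poly g) :
    Poly (fun a => f a :: g a) := prodMk hf hg

-- Encodings are injective, so the one equality instruction on trees serves all encoded types.
open Polynomial in
@[fun_prop]
theorem decide_eq [DecidableEq β] {f g : α → β} (hf : Poly f) (hg : Poly g) :
    Poly (fun a => decide (f a = g a)) := by
  have h : Poly (fun z : β × β => decide (z.1 = z.2)) := by
    refine ⟨.eq, X, fun z => ⟨(enc z).size, ?_, by simp [esize]⟩⟩
    have h : Runs .eq (enc z) (enc z).size (if enc z.1 = enc z.2 then .tt else .nil) := .eq (enc z)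
    by_cases hz : z.1 = z.2
    · rw [if_pos (congrArg enc hz)] at h
      simp only [decide_eq_true hz]
      exact h
    · rw [if_neg fun h' => hz (enc_injective h')] at h
      simp only [decide_eq_false hz]
      exact h
  exact comp h (prodMk hf hg)

open Polynomial in
@[fun_prop]
theorem cond {c : α → Bool} {f g : α → β} (hc : Poly c) (hf : Poly f) (hg : Poly g) :
    Poly (fun a => bif c a then f a else g a) := by
  obtain ⟨P, p, hP⟩ := hc
  obtain ⟨Q, q, hQ⟩ := hf
  obtain ⟨R, r, hR⟩ := hg
  refine ⟨.ite P Q R, X + p + q + r, fun a => ?_⟩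
  have h := hP a
  simp only [eval_add, eval_X]
  cases hca : c a
  · rw [hca] at h
    exact (RunsIn.ite_false h (hR a)).mono (by change esize a + _ + _ ≤ _; omega)
  · rw [hca] at h
    refine (RunsIn.ite_true h (fun h' => ?_) (hQ a)).mono (by change esize a + _ + _ ≤ _; omega)
    cases h'

@[fun_prop]
theorem not {f : α → Bool} (hf : Poly f) : Poly (fun a => !f a) := by
  have : (fun a => !f a) = fun a => bif f a then false else true := by
    funext a; cases f a <;> rfl
  rw [this]
  fun_prop

@[fun_prop]
theorem and {f g : α → Bool} (hf : Poly f) (hg : Poly g) : Poly (fun a => f a && g a) := by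
  have : (fun a => f a && g a) = fun a => bif f a then g a else false := by
    funext a; cases f a <;> rfl
  rw [this]
  fun_prop

@[fun_prop]
theorem or {f g : α → Bool} (hf : Poly f) (hg : Poly g) : Poly (fun a => f a || g a) := by
  have : (fun a => f a || g a) = fun a => bif f a then true else g a := by
    funext a; cases f a <;> rfl
  rw [this]
  fun_prop

/-- The loop that runs through a list: its state consists of the context, the rest of the list and
the accumulator. -/
theorem runsIn_foldl_loop {step : γ → β → α → β} {P : Prog} {p : Polynomial ℕ}
    (hP : ∀ z : γ × β × α, RunsIn P (enc z) (p.eval (esize z)) (enc (step z.1 z.2.1 z.2.2)))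
    (c : γ) (B : ℕ) (l : List α) (b : β) (s : ℕ)
    (hB : ∀ k, k <+: l → esize (k.foldl (step c) b) ≤ B) (hs : esize c + esize l + B + 2 ≤ s) :
    RunsIn (.loop (.comp .tl .hd) (.pair .hd (.pair (.comp .tl (.comp .hd .tl))
      (.comp (.pair .hd (.pair (.comp .tl .tl) (.comp .tl (.comp .hd .hd)))) P))))
      (enc (c, l, b)) ((l.length + 1) * (40 * s + p.eval s)) (enc (c, ([] : List α), l.foldl (step c) b)) := by
  induction l generalizing b with
  | nil =>
    have h := hB [] List.prefix_rfl
    refine (RunsIn.loop_halt (RunsIn.comp .tl .hd)).mono ?_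
    simp only [List.foldl_nil, esize, enc_pair, enc_nil, Data.size, Data.tl, List.length_nil]
      at *
    omega
  | cons a l ih =>
    -- The empty prefix bounds the current accumulator.
    have hb := hB [] (List.nil_prefix)
    have hl : ∀ k, k <+: l → esize (k.foldl (step c) (step c b a)) ≤ B := fun k hk =>
      hB (a :: k) (List.cons_prefix_cons.2 ⟨rfl, hk⟩)
    rw [esize_cons] at hs
    have hstep := (hP (c, b, a)).mono (eval_mono_nat p (n := s) (by
      simp only [esize_pair, List.foldl_nil] at hb ⊢; omega))
    refine (RunsIn.loop_again (RunsIn.comp .tl .hd) ?_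
      (RunsIn.pair .hd (RunsIn.pair (RunsIn.comp .tl (RunsIn.comp .hd .tl))
        (RunsIn.comp (RunsIn.pair .hd (RunsIn.pair (RunsIn.comp .tl .tl)
          (RunsIn.comp .tl (RunsIn.comp .hd .hd)))) hstep)))
      (ih (step c b a) hl (by omega))).mono ?_
    · exact fun h => by cases h
    -- Apart from `P`, one pass executes fewer than 40 instructions, each on data of size at most
    -- `s`.
    · simp only [List.foldl_nil, esize, enc_pair, enc_cons, Data.size, Data.tl, Data.hd,
        List.length_cons, Nat.succ_mul] at *
      omega

-- A polynomial-time step may double its argument, so iterating it can lead to exponential size.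
-- This is why a polynomial bound on the accumulator is required after every prefix of the list;
-- given it, all states of the loop have size at most `s`, and the number of passes is bounded by
-- the size of the list.
open Polynomial in
theorem foldl {L : γ → List α} {init : γ → β} {step : γ → β → α → β}
    (hstep : Poly fun z : γ × β × α => step z.1 z.2.1 z.2.2) (hL : Poly L) (hi : Poly init)
    (q : Polynomial ℕ)
    (hq : ∀ c k, k <+: L c → esize (k.foldl (step c) (init c)) ≤ q.eval (esize c)) :
    Poly fun c => (L c).foldl (step c) (init c) := by
  obtain ⟨r, hr⟩ := hL.exists_esize_le
  obtain ⟨P, p, hP⟩ := hstep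
  obtain ⟨R, m, hR⟩ := (by fun_prop : Poly fun c => (c, L c, init c))
  let s : Polynomial ℕ := X + r + q + C 2
  refine ⟨.comp R (.comp (.loop (.comp .tl .hd) (.pair .hd (.pair (.comp .tl (.comp .hd .tl))
    (.comp (.pair .hd (.pair (.comp .tl .tl) (.comp .tl (.comp .hd .hd)))) P)))) (.comp .tl .tl)),
    X + m + (s + (r + C 1) * (C 40 * s + p.comp s) + C 6 * s), fun c => ?_⟩
  have hs : s.eval (esize c) = esize c + r.eval (esize c) + q.eval (esize c) + 2 := by
    simp [s]
  have h₀ := hr c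
  have hloop := runsIn_foldl_loop hP c (q.eval (esize c)) (L c) (init c) (s.eval (esize c)) (hq c)
    (by omega)
  refine ((hR c).comp (hloop.comp (RunsIn.comp .tl .tl))).mono ?_
  have h₁ := hq c [] List.nil_prefix
  have h₂ := hq c (L c) List.prefix_rfl
  have h₃ : ((L c).length + 1) * (40 * s.eval (esize c) + p.eval (s.eval (esize c))) ≤
      (r.eval (esize c) + 1) * (40 * s.eval (esize c) + p.eval (s.eval (esize c))) :=
    Nat.mul_le_mul_right _ (by have := length_lt_esize (L c); omega)
  simp only [eval_add, eval_X, eval_mul, eval_C, eval_comp]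
  simp only [List.foldl_nil, esize, enc_pair, enc_nil, Data.size, Data.tl] at *
  omega

/-- A fold whose accumulator never grows. -/
theorem foldl_of_le {L : γ → List α} {init : γ → β} {step : γ → β → α → β}
    (hstep : Poly fun z : γ × β × α => step z.1 z.2.1 z.2.2) (hL : Poly L) (hi : Poly init)
    (hle : ∀ c b a, esize (step c b a) ≤ esize b) :
    Poly fun c => (L c).foldl (step c) (init c) := by
  obtain ⟨q, hq⟩ := hi.exists_esize_le
  refine foldl hstep hL hi q fun c k hk => le_trans ?_ (hq c)
  clear hk
  generalize init c = b
  induction k generalizing b with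
  | nil => exact le_rfl
  | cons a k ih => exact (ih (step c b a)).trans (hle c b a)

@[fun_prop]
theorem reverse {L : γ → List α} (hL : Poly L) : Poly fun c => (L c).reverse := by
  obtain ⟨q, hq⟩ := hL.exists_esize_le
  have : (fun c => (L c).reverse) = fun c => (L c).foldl (fun b a => a :: b) [] := by
    funext c
    simp
  rw [this]
  refine foldl (by fun_prop) hL (const _) q fun c k hk => ?_
  have : k.foldl (fun b a => a :: b) [] = k.reverse := by simp
  rw [this, esize_reverse]
  exact (esize_le_of_sublist hk.sublist).trans (hq c)

theorem foldr {L : γ → List α} {init : γ → β} {step : γ → α → β → β}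
    (hstep : Poly fun z : γ × α × β => step z.1 z.2.1 z.2.2) (hL : Poly L) (hi : Poly init)
    (q : Polynomial ℕ)
    (hq : ∀ c k, k <:+ L c → esize (k.foldr (step c) (init c)) ≤ q.eval (esize c)) :
    Poly fun c => (L c).foldr (step c) (init c) := by
  simp only [List.foldr_eq_foldl_reverse]
  refine foldl (step := fun c b a => step c a b) ?_ hL.reverse hi q fun c k hk => ?_
  · exact comp (g := fun z : γ × α × β => step z.1 z.2.1 z.2.2)
      (f := fun z : γ × β × α => (z.1, z.2.2, z.2.1)) hstep (by fun_prop)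
  · have := hq c k.reverse (by simpa using List.reverse_suffix.2 hk)
    rwa [List.foldr_reverse] at this

@[fun_prop]
theorem map {L : γ → List α} {f : γ → α → β} (hf : Poly fun z : γ × α => f z.1 z.2)
    (hL : Poly L) : Poly fun c => (L c).map (f c) := by
  obtain ⟨q, hq⟩ := hL.exists_esize_le
  obtain ⟨r, hr⟩ := hf.exists_esize_le
  simp only [List.map_eq_foldr]
  refine foldr (step := fun c a l => f c a :: l)
    (listCons (hf.comp (f := fun z : γ × α × List β => (z.1, z.2.1)) (by fun_prop)) (by fun_prop))
    hL (const _) (q * (r.comp (.X + q + .C 1) + .C 1) + .C 1) fun c k hk => ?_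
  rw [← List.map_eq_foldr]
  have hkq : esize k ≤ q.eval (esize c) := (esize_le_of_sublist hk.sublist).trans (hq c)
  simp only [Polynomial.eval_add, Polynomial.eval_mul, Polynomial.eval_comp, Polynomial.eval_X,
    Polynomial.eval_C]
  refine (esize_map_le (f c) (b := r.eval (esize c + q.eval (esize c) + 1)) fun a ha =>
    (hr (c, a)).trans (eval_mono_nat r ?_)).trans ?_
  · have := esize_lt_of_mem ha
    rw [esize_pair]
    omega
  · have := length_lt_esize k
    gcongr
    omega

@[fun_prop]
theorem filter {L : γ → List α} {p : γ → α → Bool} (hp : Poly fun z : γ × α => p z.1 z.2)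
    (hL : Poly L) : Poly fun c => (L c).filter (p c) := by
  obtain ⟨q, hq⟩ := hL.exists_esize_le
  have h : ∀ c (l : List α),
      l.filter (p c) = l.foldr (fun a l => bif p c a then a :: l else l) [] := by
    intro c l
    induction l with
    | nil => rfl
    | cons a l ih => rw [List.filter_cons, List.foldr_cons, ← ih]; cases p c a <;> rfl
  simp only [h]
  refine foldr (step := fun c a l => bif p c a then a :: l else l)
    (cond (hp.comp (f := fun z : γ × α × List α => (z.1, z.2.1)) (by fun_prop)) (by fun_prop)
      (by fun_prop)) hL (const _) q fun c k hk => ?_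
  rw [← h]
  exact (esize_filter_le _ k).trans ((esize_le_of_sublist hk.sublist).trans (hq c))

@[fun_prop]
theorem any {L : γ → List α} {p : γ → α → Bool} (hp : Poly fun z : γ × α => p z.1 z.2)
    (hL : Poly L) : Poly fun c => (L c).any (p c) := by
  have h : ∀ c (l : List α), l.any (p c) = l.foldr (fun a b => p c a || b) false := by
    intro c l
    induction l with
    | nil => rfl
    | cons a l ih => rw [List.any_cons, List.foldr_cons, ← ih]
  simp only [h]
  exact foldr (step := fun c a b => p c a || b)
    (or (hp.comp (f := fun z : γ × α × Bool => (z.1, z.2.1)) (by fun_prop)) (by fun_prop))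
    hL (const _) (.C 3) fun c k hk => by simpa using esize_bool _

@[fun_prop]
theorem all {L : γ → List α} {p : γ → α → Bool} (hp : Poly fun z : γ × α => p z.1 z.2)
    (hL : Poly L) : Poly fun c => (L c).all (p c) := by
  simp only [List.all_eq_not_any_not]
  fun_prop

@[fun_prop]
theorem append {k l : γ → List α} (hk : Poly k) (hl : Poly l) : Poly fun c => k c ++ l c := by
  obtain ⟨p, hp⟩ := hk.exists_esize_le
  obtain ⟨q, hq⟩ := hl.exists_esize_le
  have h : ∀ k l : List α, k ++ l = k.foldr List.cons l := by simp
  simp only [h]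
  refine foldr (step := fun _ a l => a :: l) (by fun_prop) hk hl (p + q) fun c m hm => ?_
  rw [← h, Polynomial.eval_add]
  have h₁ := esize_append m (l c)
  have h₂ := esize_le_of_sublist hm.sublist
  have h₃ := hp c
  have h₄ := hq c
  omega

@[fun_prop]
theorem flatten {L : γ → List (List α)} (hL : Poly L) : Poly fun c => (L c).flatten := by
  obtain ⟨q, hq⟩ := hL.exists_esize_le
  have h : ∀ l : List (List α), l.flatten = l.foldr (fun a b => a ++ b) [] := fun l => by
    induction l with
    | nil => rfl
    | cons a l ih => rw [List.flatten_cons, List.foldr_cons, ih]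
  simp only [h]
  refine foldr (step := fun _ a b => a ++ b) (by fun_prop) hL (const _) q fun c k hk => ?_
  rw [← h]
  exact (esize_flatten_le k).trans ((esize_le_of_sublist hk.sublist).trans (hq c))

@[fun_prop]
theorem product {k : γ → List α} {l : γ → List β} (hk : Poly k) (hl : Poly l) :
    Poly fun c => (k c).product (l c) := by
  have h : ∀ c, (k c).product (l c) = ((k c).map fun a => (l c).map fun b => (a, b)).flatten :=
    fun c => rfl
  simp only [h]
  fun_prop

end Poly

/-! ### Correctness of the pruning algorithm -/

universe u v w

theorem foldl_invariant {α : Type u} {β : Type v} {f : α → β → α} {p : α → Prop}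
    (h : ∀ a b, p a → p (f a b)) (l : List β) {a : α} (ha : p a) : p (l.foldl f a) := by
  induction l generalizing a with
  | nil => exact ha
  | cons b l ih => exact ih (h a b ha)

theorem foldl_eq_self {α : Type u} {β : Type v} {f : α → β → α} {l : List β} {a : α}
    (h : ∀ b ∈ l, f a b = a) : l.foldl f a = a := by
  induction l with
  | nil => rfl
  | cons b l ih =>
    rw [List.foldl_cons, h b List.mem_cons_self, ih fun b hb => h b (List.mem_cons_of_mem _ hb)]

/-! ### Inclusion of graphs and decreasing folds -/

namespace HostGraph

variable {L : Type u} {N : Type v}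

protected theorem le_refl (S : HostGraph L N) : S ≤ S :=
  ⟨Finset.Subset.refl _, Finset.Subset.refl _, Finset.Subset.refl _⟩

protected theorem le_trans {R S T : HostGraph L N} (h : R ≤ S) (h' : S ≤ T) : R ≤ T :=
  ⟨h.1.trans h'.1, h.2.1.trans h'.2.1, h.2.2.trans h'.2.2⟩

protected theorem le_antisymm {S T : HostGraph L N} (h : S ≤ T) (h' : T ≤ S) : S = T :=
  HostGraph.ext (h.1.antisymm h'.1) (h.2.1.antisymm h'.2.1) (h.2.2.antisymm h'.2.2)

theorem paths_mono {S T : HostGraph L N} (h : S ≤ T) (x y : N) : S.paths x y ⊆ T.paths x y :=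
  fun _ hp => ⟨fun e he => h.2.2 (hp.1 e he), hp.2⟩

theorem mem_out [DecidableEq N] {S : HostGraph L N} {x : N} {e : N × L × N} :
    e ∈ S.out x ↔ e ∈ S.edges ∧ e.1 = x := Finset.mem_filter

theorem removeEdge_le [DecidableEq L] [DecidableEq N] (S : HostGraph L N) (e : N × L × N) :
    S.removeEdge e ≤ S :=
  ⟨Finset.Subset.refl _, Finset.Subset.refl _, Finset.erase_subset _ _⟩

theorem removeNode_le [DecidableEq N] (S : HostGraph L N) (x : N) : S.removeNode x ≤ S :=
  ⟨Finset.Subset.refl _, Finset.erase_subset _ _, Finset.filter_subset _ _⟩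

theorem le_removeEdge [DecidableEq L] [DecidableEq N] {S T : HostGraph L N} {e : N × L × N}
    (h : T ≤ S) (he : e ∉ T.edges) : T ≤ S.removeEdge e :=
  ⟨h.1, h.2.1, fun _ hf => Finset.mem_erase.2 ⟨fun h' => he (h' ▸ hf), h.2.2 hf⟩⟩

/-- A graph that avoids `x` has no edge at `x` either, so the deletion of incident edges is
harmless. -/
theorem le_removeNode [DecidableEq N] {S T : HostGraph L N} {x : N}
    (h : T ≤ S) (hx : x ∉ T.nodes) : T ≤ S.removeNode x := by
  refine ⟨h.1, fun y hy => Finset.mem_erase.2 ⟨fun h' => hx (h' ▸ hy), h.2.1 hy⟩,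
    fun e he => Finset.mem_filter.2 ⟨h.2.2 he, ?_⟩⟩
  rintro (rfl | rfl)
  · exact hx (T.src_mem e he)
  · exact hx (T.tgt_mem e he)

/-- The number of nodes and edges. -/
def card (S : HostGraph L N) : ℕ := S.nodes.card + S.edges.card

/-- Symbols are not counted by `card`, so they must agree for a change to be detected. -/
theorem card_lt_of_le {S T : HostGraph L N} (h : S ≤ T) (hs : S.symbols = T.symbols)
    (hne : S ≠ T) : S.card < T.card := by
  have h₁ := Finset.card_le_card h.2.1
  have h₂ := Finset.card_le_card h.2.2
  by_contra hlt
  unfold card at hlt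
  exact hne (HostGraph.ext hs (Finset.eq_of_subset_of_card_le h.2.1 (by omega))
    (Finset.eq_of_subset_of_card_le h.2.2 (by omega)))

theorem foldl_le {β : Type w} {f : HostGraph L N → β → HostGraph L N} (hf : ∀ S b, f S b ≤ S)
    (l : List β) (S : HostGraph L N) : l.foldl f S ≤ S :=
  foldl_invariant (p := (· ≤ S)) (fun T b h => HostGraph.le_trans (hf T b) h) l (HostGraph.le_refl S)

/-- A decreasing fold that changes nothing consists of steps that change nothing. -/
theorem eq_self_of_foldl_eq {β : Type w} {f : HostGraph L N → β → HostGraph L N}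
    (hf : ∀ S b, f S b ≤ S) {l : List β} {S : HostGraph L N} (h : l.foldl f S = S) :
    ∀ b ∈ l, f S b = S := by
  induction l with
  | nil => simp
  | cons b l ih =>
    have hb : f S b = S := by
      refine HostGraph.le_antisymm (hf S b) ?_
      have := foldl_le hf l (f S b)
      rwa [← List.foldl_cons, h] at this
    rw [List.foldl_cons, hb] at h
    intro c hc
    rcases List.mem_cons.1 hc with rfl | hc
    · exact hb
    · exact ih h c hc

theorem mem_prod_edges {N' : Type w} [DecidableEq L] [DecidableEq N] [DecidableEq N']
    {G : HostGraph L N} {H : HostGraph L N'} {e : (N × N') × L × (N × N')} :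
    e ∈ (G.prod H).edges ↔
      (e.1.1, e.2.1, e.2.2.1) ∈ G.edges ∧ (e.1.2, e.2.1, e.2.2.2) ∈ H.edges := by
  simp only [prod, Finset.mem_image, Finset.mem_filter, Finset.mem_product]
  constructor
  · rintro ⟨⟨⟨u, a, v⟩, ⟨u', a', v'⟩⟩, ⟨h, h'⟩, rfl⟩
    simp only at h h'
    subst h'
    exact h
  · intro h
    exact ⟨(_, _), ⟨h, rfl⟩, rfl⟩

end HostGraph

/-! ### The invariant of the rounds and their fixed points -/

section LGS

variable {L : Type u} {N : Type v} {N' : Type w} [DecidableEq L] [DecidableEq N] [DecidableEq N']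
  {G : Guest L N} {H : HostGraph L N'} {S T : HostGraph L (N × N')}

/-- The choice set realised in `T` is still realised in the larger graph; the host edges that the
test asks for are the projections of edges of `T`. -/
theorem IsLGS.edgeSupported (hT : IsLGS G H T) (hS : T ≤ S) {e : (N × N') × L × (N × N')}
    (he : e ∈ T.edges) : EdgeSupported G H S e := by
  obtain ⟨⟨u, u'⟩, a, ⟨v, v'⟩⟩ := e
  obtain ⟨γ, hγ, haγ, h⟩ := hT.choice_edge u u' a v v' he
  refine ⟨γ, hγ, haγ, fun b x hb => ?_⟩
  obtain ⟨x', -, hx⟩ := h b x hb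
  exact ⟨x', HostGraph.mem_out.2 ⟨(HostGraph.mem_prod_edges.1 (hT.subgraph.2.2 hx)).2, rfl⟩,
    HostGraph.mem_out.2 ⟨hS.2.2 hx, rfl⟩⟩

/-- The choice set realised at `x` is either empty or provides an edge out of `x`, and paths of `T`
are paths of `S`. -/
theorem IsLGS.not_nodeRefuted (hT : IsLGS G H T) (hS : T ≤ S) {x : N × N'} (hx : x ∈ T.nodes) :
    ¬ NodeRefuted G H S x := by
  obtain ⟨u, u'⟩ := x
  rintro (⟨hout, hC⟩ | ⟨m, hm, hp, h⟩)
  · obtain ⟨γ, hγ, h⟩ := hT.choice_node u u' hx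
    obtain rfl | ⟨e, he⟩ := γ.eq_empty_or_nonempty
    · exact hC hγ
    · obtain ⟨-, heu⟩ := (G.choice_union u (Finset.mem_product.1 (hT.subgraph.2.1 hx)).1 e).1
        ⟨γ, hγ, he⟩
      obtain ⟨w, a, v⟩ := e
      obtain rfl : w = u := heu
      obtain ⟨v', -, hv⟩ := h a v he
      have : ((w, u'), a, (v, v')) ∈ S.out (w, u') := HostGraph.mem_out.2 ⟨hS.2.2 hv, rfl⟩
      rw [hout] at this
      simp at this
  · obtain ⟨v', hv', p, hp'⟩ := hT.must_reach u u' hx m hm hp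
    have := HostGraph.paths_mono hS _ _ hp'
    rw [h v' hv'] at this
    exact this

theorem pruneEdges_le (ordE : Enumeration ((N × N') × L × (N × N'))) (S : HostGraph L (N × N'))
    (x : N × N') : pruneEdges G H ordE S x ≤ S := by
  refine HostGraph.foldl_le (fun S e => ?_) _ S
  split_ifs
  · exact S.le_refl
  · exact S.removeEdge_le e

set_option linter.unusedSectionVars false in
theorem pruneNode_le (S : HostGraph L (N × N')) (x : N × N') : pruneNode G H S x ≤ S := by
  unfold pruneNode
  split_ifs
  · exact S.removeNode_le x
  · exact S.le_refl

theorem pruneRound_le (ordV : Enumeration (N × N')) (ordE : Enumeration ((N × N') × L × (N × N')))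
    (S : HostGraph L (N × N')) : pruneRound G H ordV ordE S ≤ S :=
  HostGraph.foldl_le (fun S x => HostGraph.le_trans (pruneNode_le _ x) (pruneEdges_le ordE S x)) _ S

theorem pruneEdges_symbols (ordE : Enumeration ((N × N') × L × (N × N')))
    (S : HostGraph L (N × N')) (x : N × N') : (pruneEdges G H ordE S x).symbols = S.symbols := by
  refine foldl_invariant (p := fun T : HostGraph L (N × N') => T.symbols = S.symbols)
    (fun T e h => ?_) _ rfl
  split_ifs <;> exact h

set_option linter.unusedSectionVars false in
theorem pruneNode_symbols (S : HostGraph L (N × N')) (x : N × N') :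
    (pruneNode G H S x).symbols = S.symbols := by
  unfold pruneNode
  split_ifs <;> rfl

theorem pruneRound_symbols (ordV : Enumeration (N × N'))
    (ordE : Enumeration ((N × N') × L × (N × N'))) (S : HostGraph L (N × N')) :
    (pruneRound G H ordV ordE S).symbols = S.symbols :=
  foldl_invariant (p := fun T : HostGraph L (N × N') => T.symbols = S.symbols)
    (fun _ _ h => (pruneNode_symbols _ _).trans ((pruneEdges_symbols _ _ _).trans h)) _ rfl

/-- Each test needs only that `T` lies in the graph current at that moment, and this survives every
single removal; so the orders play no role. -/
theorem IsLGS.le_pruneRound (hT : IsLGS G H T) (ordV : Enumeration (N × N'))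
    (ordE : Enumeration ((N × N') × L × (N × N'))) (hS : T ≤ S) :
    T ≤ pruneRound G H ordV ordE S := by
  refine foldl_invariant (p := (T ≤ ·)) (fun S x hS => ?_) _ hS
  have hE : T ≤ pruneEdges G H ordE S x := by
    refine foldl_invariant (p := (T ≤ ·)) (fun S e hS => ?_) _ hS
    split_ifs with h
    · exact hS
    · exact HostGraph.le_removeEdge hS fun he => h (hT.edgeSupported hS he)
  unfold pruneNode
  split_ifs with h
  · exact HostGraph.le_removeNode hE fun hx => hT.not_nodeRefuted hE hx h
  · exact hE

/-- No test of the pruning algorithm leads to a removal. -/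
def IsStable (G : Guest L N) (H : HostGraph L N') (S : HostGraph L (N × N')) : Prop :=
  (∀ e ∈ S.edges, EdgeSupported G H S e) ∧ ∀ x ∈ S.nodes, ¬ NodeRefuted G H S x

/-- Nothing removed is ever put back, so a round ending where it began passes through `S` only, and
all its tests were evaluated on `S` itself. The criterion does not depend on the orders. -/
theorem pruneRound_eq_self_iff (ordV : Enumeration (N × N'))
    (ordE : Enumeration ((N × N') × L × (N × N'))) :
    pruneRound G H ordV ordE S = S ↔ IsStable G H S := by
  constructor
  · intro h
    have hstep : ∀ x ∈ S.nodes, pruneNode G H (pruneEdges G H ordE S x) x = S := fun x hx =>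
      HostGraph.eq_self_of_foldl_eq
        (fun S x => HostGraph.le_trans (pruneNode_le _ x) (pruneEdges_le ordE S x)) h x
        ((ordV.mem_iff _ _).2 hx)
    have hE : ∀ x ∈ S.nodes, pruneEdges G H ordE S x = S := fun x hx => by
      refine HostGraph.le_antisymm (pruneEdges_le ordE S x) ?_
      have := pruneNode_le (G := G) (H := H) (pruneEdges G H ordE S x) x
      rwa [hstep x hx] at this
    refine ⟨fun e he => ?_, fun x hx hr => ?_⟩
    · have h := HostGraph.eq_self_of_foldl_eq (fun S e => by
        split_ifs
        · exact S.le_refl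
        · exact S.removeEdge_le e) (hE e.1 (S.src_mem e he)) e
        ((ordE.mem_iff _ _).2 (HostGraph.mem_out.2 ⟨he, rfl⟩))
      by_contra hsup
      rw [if_neg hsup] at h
      rw [← h] at he
      exact Finset.notMem_erase e _ he
    · have h := hstep x hx
      rw [hE x hx, pruneNode, if_pos hr] at h
      rw [← h] at hx
      exact Finset.notMem_erase x _ hx
  · rintro ⟨hE, hV⟩
    refine foldl_eq_self fun x hx => ?_
    have : pruneEdges G H ordE S x = S := foldl_eq_self fun e he =>
      if_pos (hE e (HostGraph.mem_out.1 ((ordE.mem_iff _ _).1 he)).1)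
    rw [this, pruneNode, if_neg (hV x ((ordV.mem_iff _ _).1 hx))]

/-- `S` is a subgraph of the product that contains all loose graph simulations. -/
structure IsUpperApprox (G : Guest L N) (H : HostGraph L N') (S : HostGraph L (N × N')) :
    Prop where
  symbols_eq : S.symbols = G.symbols ∩ H.symbols
  le_prod : S ≤ G.toHostGraph.prod H
  le_of_isLGS : ∀ T, IsLGS G H T → T ≤ S

theorem isUpperApprox_prod (G : Guest L N) (H : HostGraph L N') :
    IsUpperApprox G H (G.toHostGraph.prod H) :=
  ⟨rfl, HostGraph.le_refl _, fun _ hT => hT.subgraph⟩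

theorem IsUpperApprox.pruneRound (hS : IsUpperApprox G H S) (ordV : Enumeration (N × N'))
    (ordE : Enumeration ((N × N') × L × (N × N'))) :
    IsUpperApprox G H (pruneRound G H ordV ordE S) :=
  ⟨(pruneRound_symbols ordV ordE S).trans hS.symbols_eq,
    HostGraph.le_trans (pruneRound_le ordV ordE S) hS.le_prod,
    fun T hT => hT.le_pruneRound ordV ordE (hS.le_of_isLGS T hT)⟩

/-- Induction on the number of nodes and edges, which drops in every round but the last; the last
one accounts for the `+ 1`. -/
theorem exists_pruneLoop (ordV : Enumeration (N × N'))
    (ordE : Enumeration ((N × N') × L × (N × N'))) (hS : IsUpperApprox G H S) :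
    ∃ n T, PruneLoop G H ordV ordE S n T ∧ n ≤ S.card + 1 ∧ IsUpperApprox G H T ∧
      IsStable G H T := by
  induction hk : S.card using Nat.strong_induction_on generalizing S with
  | _ k ih =>
    by_cases h : pruneRound G H ordV ordE S = S
    · exact ⟨1, S, .halt S (by rw [h]) (by rw [h]), by omega, hS,
        (pruneRound_eq_self_iff ordV ordE).1 h⟩
    · have hlt := HostGraph.card_lt_of_le (pruneRound_le ordV ordE S)
        (pruneRound_symbols ordV ordE S) h
      obtain ⟨n, T, hT, hn, hT'⟩ := ih _ (hk ▸ hlt) (hS.pruneRound ordV ordE) rfl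
      refine ⟨n + 1, T, .again S T n ?_ hT, by omega, hT'⟩
      by_contra! h'
      exact h (HostGraph.ext (pruneRound_symbols ordV ordE S) h'.1 h'.2)

/-- The passed tests are exactly the local conditions on an LGS. The conditions on unique and
exclusive nodes, which pruning does not enforce, are vacuous. -/
theorem IsUpperApprox.isLGS (hS : IsUpperApprox G H S) (hU : G.unique = ∅) (hI : G.exclusive = ∅)
    (h : IsStable G H S) (hM : ∀ m ∈ G.must, ∃ v ∈ H.nodes, (m, v) ∈ S.nodes) :
    IsLGS G H S where
  symbols_eq := hS.symbols_eq
  subgraph := hS.le_prod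
  must_occurs := hM
  unique_occurs := by simp [hU]
  exclusive_occurs := by simp [hI]
  choice_node u u' hu := by
    by_cases hC : ∅ ∈ G.choice u
    · exact ⟨∅, hC, by simp⟩
    -- Without an empty choice set there must be an outgoing edge, and the choice set that supports
    -- this edge is realised.
    · have hne : S.out (u, u') ≠ ∅ := fun hout => h.2 _ hu (Or.inl ⟨hout, hC⟩)
      obtain ⟨e, he⟩ := Finset.nonempty_iff_ne_empty.2 hne
      obtain ⟨he, heu⟩ := HostGraph.mem_out.1 he
      obtain ⟨γ, hγ, -, hsup⟩ := h.1 e he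
      rw [heu] at hγ hsup
      refine ⟨γ, hγ, fun a v hav => ?_⟩
      obtain ⟨v', hv', hv⟩ := hsup a v hav
      exact ⟨v', H.tgt_mem _ (HostGraph.mem_out.1 hv').1, (HostGraph.mem_out.1 hv).1⟩
  choice_edge u u' a v v' he := by
    obtain ⟨γ, hγ, haγ, hsup⟩ := h.1 _ he
    refine ⟨γ, hγ, haγ, fun b x hb => ?_⟩
    obtain ⟨x', hx', hx⟩ := hsup b x hb
    exact ⟨x', H.tgt_mem _ (HostGraph.mem_out.1 hx').1, (HostGraph.mem_out.1 hx).1⟩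
  must_reach u u' hu m hm hp := by
    by_contra! hc
    exact h.2 _ hu (Or.inr ⟨m, hm, hp, hc⟩)

/-- `r` is the greatest loose graph simulation, or `none` if there is no loose graph
simulation. -/
def IsPruningResult (G : Guest L N) (H : HostGraph L N') (r : Option (HostGraph L (N × N'))) :
    Prop :=
  (∀ S, r = some S ↔ IsGreatest (LGS G H) S) ∧ (r = none ↔ LGS G H = ∅)

/-- A must node that does not occur in `S` occurs in no LGS, since all of them lie in `S`. -/
theorem isPruningResult_pruneReturn (hU : G.unique = ∅) (hI : G.exclusive = ∅)
    (hS : IsUpperApprox G H S) (h : IsStable G H S) :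
    IsPruningResult G H (pruneReturn G H S) := by
  unfold pruneReturn
  split_ifs with hM
  · have hgr : IsGreatest (LGS G H) S :=
      ⟨hS.isLGS hU hI h hM, fun T hT => hS.le_of_isLGS T hT⟩
    refine ⟨fun T => ⟨fun hT => Option.some.inj hT ▸ hgr, fun hT => ?_⟩, ?_⟩
    · rw [HostGraph.le_antisymm (hT.2 hgr.1) (hgr.2 hT.1)]
    · simp only [reduceCtorEq, false_iff]
      exact Set.Nonempty.ne_empty ⟨S, hgr.1⟩
  · have hemp : LGS G H = ∅ := by
      refine Set.eq_empty_of_forall_notMem fun T hT => hM fun m hm => ?_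
      obtain ⟨v, hv, hmv⟩ := IsLGS.must_occurs hT m hm
      exact ⟨v, hv, (hS.le_of_isLGS T hT).2.1 hmv⟩
    refine ⟨fun T => ⟨fun hT => by simp at hT, fun hT => ?_⟩, by simp [hemp]⟩
    have := hT.1
    simp [hemp] at this

/-- This carries a result computed with particular loop orders over to runs with any other orders.
-/
theorem IsPruningResult.unique {r r' : Option (HostGraph L (N × N'))}
    (h : IsPruningResult G H r) (h' : IsPruningResult G H r') : r = r' := by
  cases r with
  | none => exact (h'.2.2 (h.2.1 rfl)).symm
  | some S => exact ((h'.1 S).2 ((h.1 S).1 rfl)).symm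

theorem exists_pruningRun (hU : G.unique = ∅) (hI : G.exclusive = ∅)
    (ordV : Enumeration (N × N')) (ordE : Enumeration ((N × N') × L × (N × N'))) :
    ∃ n r, PruningRun G H ordV ordE n r ∧ n ≤ (G.toHostGraph.prod H).card + 1 ∧
      IsPruningResult G H r := by
  obtain ⟨n, T, hT, hn, hTS, hst⟩ := exists_pruneLoop ordV ordE (isUpperApprox_prod G H)
  exact ⟨n, _, ⟨T, hT, rfl⟩, hn, isPruningResult_pruneReturn hU hI hTS hst⟩

theorem IsPruningResult.exists_pruningRun {r : Option (HostGraph L (N × N'))}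
    (h : IsPruningResult G H r) (hU : G.unique = ∅) (hI : G.exclusive = ∅)
    (ordV : Enumeration (N × N')) (ordE : Enumeration ((N × N') × L × (N × N'))) :
    ∃ n, PruningRun G H ordV ordE n r := by
  obtain ⟨n, r', hr', -, h'⟩ := LooseSim.exists_pruningRun (H := H) hU hI ordV ordE
  exact ⟨n, h.unique h' ▸ hr'⟩

/-- Enumeration in an arbitrary order. -/
noncomputable def Enumeration.default (α : Type u) : Enumeration α :=
  ⟨Finset.toList, Finset.nodup_toList, fun _ _ => Finset.mem_toList⟩

theorem exists_isGreatest_of_nonempty (hU : G.unique = ∅) (hI : G.exclusive = ∅)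
    (h : (LGS G H).Nonempty) : ∃ S, IsGreatest (LGS G H) S := by
  obtain ⟨-, r, -, -, hr⟩ := exists_pruningRun (H := H) hU hI (Enumeration.default _)
    (Enumeration.default _)
  cases r with
  | none => exact absurd (hr.2.1 rfl) h.ne_empty
  | some S => exact ⟨S, (hr.1 S).1 rfl⟩

/-- Graphs that are obtained by `k` rounds, in which the orders of the loops may vary. -/
inductive PruneRounds (G : Guest L N) (H : HostGraph L N') (S : HostGraph L (N × N')) :
    ℕ → HostGraph L (N × N') → Prop
  | zero : PruneRounds G H S 0 S
  | succ {k : ℕ} {T : HostGraph L (N × N')} (h : PruneRounds G H S k T)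
      (ordV : Enumeration (N × N')) (ordE : Enumeration ((N × N') × L × (N × N'))) :
      PruneRounds G H S (k + 1) (pruneRound G H ordV ordE T)

theorem PruneRounds.isUpperApprox {k : ℕ} (h : PruneRounds G H S k T)
    (hS : IsUpperApprox G H S) : IsUpperApprox G H T := by
  induction h with
  | zero => exact hS
  | succ _ ordV ordE ih => exact ih.pruneRound ordV ordE

theorem PruneRounds.isStable_or_card_le {k : ℕ} (h : PruneRounds G H S k T) :
    IsStable G H T ∨ T.card + k ≤ S.card := by
  induction h with
  | zero => exact Or.inr le_rfl
  | @succ k T _ ordV ordE ih =>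
    by_cases hT : pruneRound G H ordV ordE T = T
    · rw [hT]
      exact Or.inl ((pruneRound_eq_self_iff ordV ordE).1 hT)
    · have hlt := HostGraph.card_lt_of_le (pruneRound_le ordV ordE T)
        (pruneRound_symbols ordV ordE T) hT
      rcases ih with ih | ih
      · exact absurd ((pruneRound_eq_self_iff ordV ordE).2 ih) hT
      · exact Or.inr (by omega)

/-- A number of rounds fixed in advance suffices, so a program can do without the test for a change.
-/
theorem PruneRounds.isStable {k : ℕ} (h : PruneRounds G H S k T) (hk : S.card ≤ k) :
    IsStable G H T := by
  rcases h.isStable_or_card_le with h | h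
  · exact h
  -- If every round removed something, no node or edge is left, and the tests hold vacuously.
  · have hc : T.card = 0 := by omega
    unfold HostGraph.card at hc
    have hV := Finset.card_eq_zero.1 (show T.nodes.card = 0 by omega)
    have hE := Finset.card_eq_zero.1 (show T.edges.card = 0 by omega)
    exact ⟨by simp [hE], by simp [hV]⟩

end LGS

/-! ### The algorithm on lists -/

/-- Graphs given by the lists of their symbols, nodes and edges. -/
abbrev GraphList (N : Type) : Type := List Data × List N × List (N × Data × N)

/-- Choice functions given by the list of their values. -/
abbrev ChoiceList : Type := List (Data × List (List (Data × Data × Data)))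

/-- Guests given by lists. -/
abbrev GuestList : Type := GraphList Data × List Data × List Data × List Data × ChoiceList

/-- Edges of the product. -/
abbrev ProdEdge : Type := (Data × Data) × Data × (Data × Data)

/-- The edges of `E` that lie on walks with start `x`. -/
def reachEdges {N : Type} [DecidableEq N] (E : List (N × Data × N)) (x : N) :
    List (N × Data × N) :=
  E.foldl (fun R _ => E.filter fun e => decide (e.1 = x) || R.any fun f => decide (f.2.2 = e.1)) []

/-- The host is not consulted: for edges of the product the required host edge is a projection. -/
def edgeSupportedList (C : ChoiceList) (E : List ProdEdge) (e : ProdEdge) : Bool :=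
  C.any fun c => decide (c.1 = e.1.1) && c.2.any fun γ =>
    (γ.any fun g => decide (g = (e.1.1, e.2.1, e.2.2.1))) &&
      γ.all fun g => E.any fun f => decide ((f.1, f.2.1, f.2.2.1) = (e.1, g.2.1, g.2.2))

def pruneEdgesList (C : ChoiceList) (E : List ProdEdge) (x : Data × Data) : List ProdEdge :=
  (E.filter fun e => decide (e.1 = x)).foldl
    (fun E e => bif edgeSupportedList C E e then E else E.filter fun f => !decide (f = e)) E

def nodeRefutedList (g : GuestList) (E : List ProdEdge) (x : Data × Data) : Bool :=
  (!(E.any fun e => decide (e.1 = x)) &&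
    !(g.2.2.2.2.any fun c => decide (c.1 = x.1) && c.2.any fun γ => decide (γ = []))) ||
  g.2.1.any fun m => ((reachEdges g.1.2.2 x.1).any fun e => decide (e.2.2 = m)) &&
    !((reachEdges E x).any fun e => decide (e.2.2.1 = m))

def pruneNodeList (g : GuestList) (S : List (Data × Data) × List ProdEdge) (x : Data × Data) :
    List (Data × Data) × List ProdEdge :=
  bif nodeRefutedList g S.2 x then
    (S.1.filter fun y => !decide (y = x),
      S.2.filter fun e => !(decide (e.1 = x) || decide (e.2.2 = x)))
  else S

def pruneRoundList (g : GuestList) (S : List (Data × Data) × List ProdEdge) :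
    List (Data × Data) × List ProdEdge :=
  S.1.foldl (fun S x => pruneNodeList g (S.1, pruneEdgesList g.2.2.2.2 S.2 x) x) S

def prodList (g h : GraphList Data) : GraphList (Data × Data) :=
  (g.1.filter fun a => h.1.any fun b => decide (a = b), g.2.1.product h.2.1,
    ((g.2.2.product h.2.2).filter fun p => decide (p.1.2.1 = p.2.2.1)).map
      fun p => ((p.1.1, p.2.1), p.1.2.1, (p.1.2.2, p.2.2.2)))

/-- The lists of nodes and edges of the product serve only as counters, for `|V| + |E|` rounds. -/
def pruneList (i : GuestList × GraphList Data) : List (Data × Data) × List ProdEdge :=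
  (prodList i.1.1 i.2).2.2.foldl (fun S _ => pruneRoundList i.1 S)
    ((prodList i.1.1 i.2).2.1.foldl (fun S _ => pruneRoundList i.1 S) (prodList i.1.1 i.2).2)

/-- `nil` cannot be mistaken for a graph, whose code is a `cons`. -/
def pruneReturnList (i : GuestList × GraphList Data) : Data :=
  bif i.1.2.1.all fun m => (pruneList i).1.any fun x => decide (x.1 = m) then
    enc ((prodList i.1.1 i.2).1, pruneList i)
  else .nil

theorem esize_pruneEdgesList_le (C : ChoiceList) (E : List ProdEdge) (x : Data × Data) :
    esize (pruneEdgesList C E x) ≤ esize E := by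
  refine foldl_invariant (p := fun F : List ProdEdge => esize F ≤ esize E) (fun F e h => ?_) _
    le_rfl
  cases edgeSupportedList C F e
  · exact (esize_filter_le _ F).trans h
  · exact h

theorem esize_pruneNodeList_le (g : GuestList) (S : List (Data × Data) × List ProdEdge)
    (x : Data × Data) : esize (pruneNodeList g S x) ≤ esize S := by
  unfold pruneNodeList
  cases nodeRefutedList g S.2 x
  · exact le_rfl
  · have h₁ := esize_filter_le (fun y => !decide (y = x)) S.1
    have h₂ := esize_filter_le (fun e => !(decide (e.1 = x) || decide (e.2.2 = x))) S.2
    change esize (_, _) ≤ esize (S.1, S.2)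
    rw [esize_pair, esize_pair]
    omega

theorem esize_pruneStepList_le (g : GuestList) (S : List (Data × Data) × List ProdEdge)
    (x : Data × Data) :
    esize (pruneNodeList g (S.1, pruneEdgesList g.2.2.2.2 S.2 x) x) ≤ esize S := by
  refine (esize_pruneNodeList_le g _ x).trans ?_
  change _ ≤ esize (S.1, S.2)
  rw [esize_pair, esize_pair]
  have := esize_pruneEdgesList_le g.2.2.2.2 S.2 x
  omega

theorem esize_pruneRoundList_le (g : GuestList) (S : List (Data × Data) × List ProdEdge) :
    esize (pruneRoundList g S) ≤ esize S :=
  foldl_invariant (p := fun T : List (Data × Data) × List ProdEdge => esize T ≤ esize S)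
    (fun T x h => (esize_pruneStepList_le g T x).trans h) _ le_rfl

/-! ### Polynomial time of the algorithm on lists -/

namespace Poly

variable {γ : Type} [Enc γ]

-- Every accumulator is empty or a filtered copy of the edge list, hence no larger than that list.
@[fun_prop]
theorem reachEdges {N : Type} [Enc N] [DecidableEq N] {E : γ → List (N × Data × N)} {x : γ → N}
    (hE : Poly E) (hx : Poly x) : Poly fun c => reachEdges (E c) (x c) := by
  obtain ⟨q, hq⟩ := hE.exists_esize_le
  refine foldl (step := fun c R _ => (E c).filter fun e => decide (e.1 = x c) ||
    R.any fun f => decide (f.2.2 = e.1)) (by fun_prop) hE (const _) q fun c k _ => ?_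
  refine foldl_invariant (p := fun R : List (N × Data × N) => esize R ≤ q.eval (esize c))
    (fun R e h => ?_) k ?_
  · exact (esize_filter_le _ _).trans (hq c)
  · exact (esize_pos (E c)).trans (hq c)

@[fun_prop]
theorem edgeSupportedList {C : γ → ChoiceList} {E : γ → List ProdEdge} {e : γ → ProdEdge}
    (hC : Poly C) (hE : Poly E) (he : Poly e) :
    Poly fun c => edgeSupportedList (C c) (E c) (e c) := by
  unfold LooseSim.edgeSupportedList
  fun_prop

@[fun_prop]
theorem pruneEdgesList {C : γ → ChoiceList} {E : γ → List ProdEdge} {x : γ → Data × Data}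
    (hC : Poly C) (hE : Poly E) (hx : Poly x) :
    Poly fun c => pruneEdgesList (C c) (E c) (x c) := by
  refine foldl_of_le (step := fun c E e => bif LooseSim.edgeSupportedList (C c) E e then E else
    E.filter fun f => !decide (f = e)) (by fun_prop) (by fun_prop) hE fun c F e => ?_
  cases LooseSim.edgeSupportedList (C c) F e
  · exact esize_filter_le _ F
  · exact le_rfl

@[fun_prop]
theorem nodeRefutedList {g : γ → GuestList} {E : γ → List ProdEdge} {x : γ → Data × Data}
    (hg : Poly g) (hE : Poly E) (hx : Poly x) :
    Poly fun c => nodeRefutedList (g c) (E c) (x c) := by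
  unfold LooseSim.nodeRefutedList
  fun_prop

@[fun_prop]
theorem pruneNodeList {g : γ → GuestList} {S : γ → List (Data × Data) × List ProdEdge}
    {x : γ → Data × Data} (hg : Poly g) (hS : Poly S) (hx : Poly x) :
    Poly fun c => pruneNodeList (g c) (S c) (x c) := by
  unfold LooseSim.pruneNodeList
  fun_prop

@[fun_prop]
theorem pruneRoundList {g : γ → GuestList} {S : γ → List (Data × Data) × List ProdEdge}
    (hg : Poly g) (hS : Poly S) : Poly fun c => pruneRoundList (g c) (S c) :=
  foldl_of_le (step := fun c S x => LooseSim.pruneNodeList (g c)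
    (S.1, LooseSim.pruneEdgesList (g c).2.2.2.2 S.2 x) x) (by fun_prop) (by fun_prop) hS
    fun c => esize_pruneStepList_le (g c)

@[fun_prop]
theorem prodList {g h : γ → GraphList Data} (hg : Poly g) (hh : Poly h) :
    Poly fun c => prodList (g c) (h c) := by
  unfold LooseSim.prodList
  fun_prop

/-- Iterated rounds, counted by a list. -/
theorem iterate_pruneRoundList {β : Type} [Enc β] {g : γ → GuestList} {L : γ → List β}
    {S : γ → List (Data × Data) × List ProdEdge} (hg : Poly g) (hL : Poly L) (hS : Poly S) :
    Poly fun c => (L c).foldl (fun S _ => LooseSim.pruneRoundList (g c) S) (S c) :=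
  foldl_of_le (step := fun c S _ => LooseSim.pruneRoundList (g c) S) (by fun_prop) hL hS
    fun c S _ => esize_pruneRoundList_le (g c) S

theorem pruneList : Poly pruneList := by
  unfold LooseSim.pruneList
  exact iterate_pruneRoundList (by fun_prop) (by fun_prop)
    (iterate_pruneRoundList (by fun_prop) (by fun_prop) (by fun_prop))

theorem pruneReturnList : Poly pruneReturnList := by
  have h := pruneList
  refine cond (by fun_prop) (toData ?_) (const _)
  fun_prop

end Poly

/-! ### Correctness of the algorithm on lists -/

/-! ### Reachability by iterated filtering -/

section Reach

variable {N : Type} [DecidableEq N]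

/-- The iterates of the monotone operator `F`, started at `[]`, form an increasing chain of sublists
of `E`. Until it becomes stationary each step adds an edge, so after `E.length` steps a fixed point
is reached, and a fixed point has the closure property. -/
theorem mem_reachEdges_of_closed (E : List (N × Data × N)) (x : N) {e : N × Data × N}
    (he : e ∈ E) (h : e.1 = x ∨ ∃ f ∈ reachEdges E x, f.2.2 = e.1) : e ∈ reachEdges E x := by
  let F : List (N × Data × N) → List (N × Data × N) := fun R =>
    E.filter fun e => decide (e.1 = x) || R.any fun f => decide (f.2.2 = e.1)
  have hF : reachEdges E x = F^[E.length] [] := List.foldl_const F [] E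
  have hmono : ∀ R R' : List (N × Data × N), R ⊆ R' → (F R).Sublist (F R') := by
    intro R R' hR
    refine List.monotone_filter_right E fun e he => ?_
    simp only [Bool.or_eq_true, decide_eq_true_eq, List.any_eq_true] at he ⊢
    exact he.imp_right fun ⟨f, hf, h⟩ => ⟨f, hR hf, h⟩
  have hsub : ∀ k, (F^[k] []).Sublist (F^[k + 1] []) := by
    intro k
    induction k with
    | zero => exact List.nil_sublist _
    | succ k ih =>
      rw [Function.iterate_succ_apply', Function.iterate_succ_apply' F (k + 1)]
      exact hmono _ _ ih.subset
  -- Either the chain is stationary from `k` on, or `k + 1` strict steps have produced at least `k +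
  -- 1` edges.
  have hgrow : ∀ k, F^[k + 1] [] = F^[k] [] ∨ k < (F^[k + 1] []).length := by
    intro k
    induction k with
    | zero =>
      rcases Nat.eq_zero_or_pos (F^[0 + 1] []).length with h | h
      · exact Or.inl (List.eq_nil_of_length_eq_zero h)
      · exact Or.inr h
    | succ k ih =>
      by_cases h : F^[k + 1 + 1] [] = F^[k + 1] []
      · exact Or.inl h
      · rcases ih with ih | ih
        · refine absurd ?_ h
          rw [Function.iterate_succ_apply', ih, ← Function.iterate_succ_apply' F k, ih]
        · refine Or.inr ?_
          by_contra hlt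
          exact h ((hsub (k + 1)).eq_of_length_le (by omega)).symm
  have hfix : F (reachEdges E x) = reachEdges E x := by
    rw [hF, ← Function.iterate_succ_apply' F]
    rcases hgrow E.length with h | h
    · exact h
    · have : (F^[E.length + 1] []).length ≤ E.length := by
        rw [Function.iterate_succ_apply']
        exact List.length_filter_le _ _
      omega
  rw [← hfix]
  refine List.mem_filter.2 ⟨he, ?_⟩
  simpa using h

/-- By the closure property the edges of a path from `x` are found one after the other; conversely,
every edge in an iterate is the last edge of some path from `x`. -/
theorem paths_nonempty_iff {M : HostGraph Data N} {E : List (N × Data × N)}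
    (hE : ∀ e, e ∈ E ↔ e ∈ M.edges) (x y : N) :
    (M.paths x y).Nonempty ↔ ∃ e ∈ reachEdges E x, e.2.2 = y := by
  constructor
  · rintro ⟨p, hp, hc, ⟨a, ha, hax⟩, ⟨b, hb, rfl⟩⟩
    refine ⟨b, ?_, rfl⟩
    -- Paths that continue an edge already found are admitted too, so that the induction applies to
    -- tails.
    have key : ∀ q : List (N × Data × N), (∀ e ∈ q, e ∈ M.edges) →
        q.IsChain (fun e f => f.1 = e.2.2) →
        (∀ e ∈ q.head?, e.1 = x ∨ ∃ f ∈ reachEdges E x, f.2.2 = e.1) →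
        ∀ e ∈ q, e ∈ reachEdges E x := by
      intro q
      induction q with
      | nil => simp
      | cons e q ih =>
        intro h₁ h₂ h₃ f hf
        have he : e ∈ reachEdges E x := mem_reachEdges_of_closed E x
          ((hE e).2 (h₁ e List.mem_cons_self)) (h₃ e rfl)
        rcases List.mem_cons.1 hf with rfl | hf
        · exact he
        · rw [List.isChain_cons] at h₂
          exact ih (fun e he => h₁ e (List.mem_cons_of_mem _ he)) h₂.2
            (fun g hg => Or.inr ⟨e, he, (h₂.1 g hg).symm⟩) f hf
    refine key p hp hc (fun e he => ?_) b (List.mem_of_mem_getLast? hb)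
    rw [Option.mem_unique he ha]
    exact Or.inl hax
  · rintro ⟨e, he, rfl⟩
    refine foldl_invariant
      (p := fun R : List (N × Data × N) => ∀ e ∈ R, (M.paths x e.2.2).Nonempty)
      (fun R _ hR e he => ?_) E (a := []) (by simp) e he
    obtain ⟨heE, h⟩ := List.mem_filter.1 he
    have heM := (hE e).1 heE
    simp only [Bool.or_eq_true, decide_eq_true_eq, List.any_eq_true] at h
    rcases h with h | ⟨f, hf, hfe⟩
    · exact ⟨[e], by simpa using heM, by simp, ⟨e, rfl, h⟩, ⟨e, rfl, rfl⟩⟩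
    · obtain ⟨p, hp, hc, ⟨a, ha, hax⟩, ⟨b, hb, hbf⟩⟩ := hR f hf
      refine ⟨p ++ [e], ?_, ?_, ⟨a, ?_, hax⟩, ⟨e, by simp, rfl⟩⟩
      · intro g hg
        rcases List.mem_append.1 hg with hg | hg
        · exact hp g hg
        · rw [List.mem_singleton.1 hg]
          exact heM
      · refine List.isChain_append.2 ⟨hc, by simp, fun c hc g hg => ?_⟩
        rw [Option.mem_unique hc hb, hbf, hfe]
        simp only [List.head?_cons, Option.mem_def, Option.some.injEq] at hg
        rw [hg]
      · rw [List.head?_append]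
        simp only [Option.mem_def] at ha ⊢
        rw [ha]
        rfl

end Reach

/-! ### From codes to lists -/

/-- `l` lists the elements of `s` without repetition. -/
def Lists {α : Type} (l : List α) (s : Finset α) : Prop :=
  l.Nodup ∧ ∀ a, a ∈ l ↔ a ∈ s

theorem Lists.length_eq {α : Type} {l : List α} {s : Finset α} (h : Lists l s) :
    l.length = s.card := by
  classical
  rw [← List.toFinset_card_of_nodup h.1]
  congr 1
  ext a
  simp [h.2 a]

theorem forall₂_eq_enc_iff {α : Type} [Enc α] {l : List α} {ds : List Data} :
    List.Forall₂ (fun a c => c = enc a) l ds ↔ ds = l.map enc := by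
  induction l generalizing ds with
  | nil => simp
  | cons a l ih =>
    cases ds with
    | nil => simp
    | cons d ds => simp [ih]

theorem isListing_enc_iff {α : Type} [Enc α] {s : Finset α} {d : Data} :
    IsListing (fun a c => c = enc a) s d ↔ ∃ l, Lists l s ∧ d = enc l := by
  constructor
  · rintro ⟨l, ds, h₁, h₂, h₃, rfl⟩
    exact ⟨l, ⟨h₁, h₂⟩, by rw [forall₂_eq_enc_iff.1 h₃]; rfl⟩
  · rintro ⟨l, h, rfl⟩
    exact ⟨l, _, h.1, h.2, forall₂_eq_enc_iff.2 rfl, rfl⟩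

/-- Meant for nested listings, where an element has many codes: the values of the choice function,
and the choice sets inside them. Freedom from repetition is dropped, as the tests on choice sets do
not depend on it. -/
theorem exists_list_of_isListing {α β : Type} [Enc β] {R : α → Data → Prop} {Q : α → β → Prop}
    (hR : ∀ a c, R a c → ∃ b, c = enc b ∧ Q a b) {s : Finset α} {d : Data}
    (h : IsListing R s d) :
    ∃ l : List β, d = enc l ∧ (∀ a ∈ s, ∃ b ∈ l, Q a b) ∧ ∀ b ∈ l, ∃ a ∈ s, Q a b := by
  obtain ⟨l, ds, -, hs, hl, rfl⟩ := h
  suffices ∃ m : List β, Data.ofList ds = enc m ∧ (∀ a ∈ l, ∃ b ∈ m, Q a b) ∧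
      ∀ b ∈ m, ∃ a ∈ l, Q a b by simpa only [hs] using this
  clear hs
  induction hl with
  | nil => exact ⟨[], rfl, by simp, by simp⟩
  | @cons a c l ds hac _ ih =>
    obtain ⟨m, hm, h₁, h₂⟩ := ih
    obtain ⟨b, rfl, hab⟩ := hR a c hac
    refine ⟨b :: m, ?_, ?_, ?_⟩
    · rw [Data.ofList, hm, enc_cons]
    · simp only [List.mem_cons, forall_eq_or_imp, exists_eq_or_imp]
      exact ⟨Or.inl hab, fun a' ha' => Or.inr (h₁ a' ha')⟩
    · simp only [List.mem_cons, forall_eq_or_imp, exists_eq_or_imp]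
      exact ⟨Or.inl hab, fun b' hb' => Or.inr (h₂ b' hb')⟩

/-- `g` lists the symbols, nodes and edges of `M`. -/
def ListsGraph {N : Type} (g : GraphList N) (M : HostGraph Data N) : Prop :=
  Lists g.1 M.symbols ∧ Lists g.2.1 M.nodes ∧ Lists g.2.2 M.edges

theorem isGraphCode_enc_iff {N : Type} [Enc N] {M : HostGraph Data N} {d : Data} :
    IsGraphCode enc M d ↔ ∃ g, ListsGraph g M ∧ d = enc g := by
  have hE : (fun (e : N × Data × N) c => c = edgeCode enc e) = fun e c => c = enc e := rfl
  have hS : (fun a c : Data => c = a) = fun a c => c = enc a := rfl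
  unfold IsGraphCode
  simp only [hE, hS, isListing_enc_iff]
  constructor
  · rintro ⟨_, _, _, rfl, ⟨a, ha, rfl⟩, ⟨b, hb, rfl⟩, ⟨c, hc, rfl⟩⟩
    exact ⟨(a, b, c), ⟨ha, hb, hc⟩, rfl⟩
  · rintro ⟨⟨a, b, c⟩, ⟨ha, hb, hc⟩, rfl⟩
    exact ⟨_, _, _, rfl, ⟨a, ha, rfl⟩, ⟨b, hb, rfl⟩, ⟨c, hc, rfl⟩⟩

/-- The lists of `k` represent the sets in `s`. -/
def ListsSets {α : Type} (k : List (List α)) (s : Finset (Finset α)) : Prop :=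
  (∀ γ ∈ s, ∃ l ∈ k, ∀ e, e ∈ l ↔ e ∈ γ) ∧ ∀ l ∈ k, ∃ γ ∈ s, ∀ e, e ∈ l ↔ e ∈ γ

/-- `g` represents the graph, the must set and the choice function of `G`. -/
structure ListsGuest (g : GuestList) (G : Guest Data Data) : Prop where
  graph : ListsGraph g.1 G.toHostGraph
  must : Lists g.2.1 G.must
  exists_choice : ∀ x ∈ G.nodes, ∃ c ∈ g.2.2.2.2, c.1 = x
  choice : ∀ c ∈ g.2.2.2.2, ListsSets c.2 (G.choice c.1)

theorem exists_listsGuest {G : Guest Data Data} {d : Data} (h : IsGuestCode G d) :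
    ∃ g, ListsGuest g G ∧ d = enc g := by
  obtain ⟨_, _, _, _, _, rfl, hG, hM, hU, hI, hC⟩ := h
  obtain ⟨g, hg, rfl⟩ := isGraphCode_enc_iff.1 hG
  obtain ⟨M, hM', rfl⟩ := isListing_enc_iff.1 hM
  obtain ⟨U, -, rfl⟩ := isListing_enc_iff.1 hU
  obtain ⟨I, -, rfl⟩ := isListing_enc_iff.1 hI
  obtain ⟨C, rfl, h₁, h₂⟩ := exists_list_of_isListing
    (Q := fun x (c : Data × List (List (Data × Data × Data))) =>
      c.1 = x ∧ ListsSets c.2 (G.choice x)) (by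
    rintro x _ ⟨k, rfl, hk⟩
    obtain ⟨l, rfl, h₁, h₂⟩ := exists_list_of_isListing
      (Q := fun (γ : Finset (Data × Data × Data)) (l : List (Data × Data × Data)) =>
        ∀ e, e ∈ l ↔ e ∈ γ) (fun γ c hγ => by
      obtain ⟨l, hl, rfl⟩ := isListing_enc_iff.1 hγ
      exact ⟨l, rfl, hl.2⟩) hk
    exact ⟨(x, l), rfl, rfl, h₁, h₂⟩) hC
  refine ⟨(g, M, U, I, C), ⟨hg, hM', fun x hx => ?_, fun c hc => ?_⟩, rfl⟩
  · obtain ⟨c, hc, h, -⟩ := h₁ x hx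
    exact ⟨c, hc, h⟩
  · obtain ⟨x, -, rfl, h⟩ := h₂ c hc
    exact h

theorem listsGraph_prodList {g h : GraphList Data} {G H : HostGraph Data Data}
    (hg : ListsGraph g G) (hh : ListsGraph h H) : ListsGraph (prodList g h) (G.prod H) := by
  refine ⟨⟨hg.1.1.filter _, fun a => ?_⟩, ⟨hg.2.1.1.product hh.2.1.1, fun x => ?_⟩, ?_, fun e => ?_⟩
  · simp [prodList, HostGraph.prod, hg.1.2, hh.1.2]
  · obtain ⟨x, y⟩ := x
    simp [prodList, HostGraph.prod, hg.2.1.2, hh.2.1.2]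
  -- The map to product edges forgets the second label, so it is injective only on pairs with equal
  -- labels.
  · refine List.Nodup.map_on ?_ ((hg.2.2.1.product hh.2.2.1).filter _)
    rintro ⟨⟨u, a, v⟩, u', a', v'⟩ h₁ ⟨⟨w, b, z⟩, w', b', z'⟩ h₂ h
    simp only [List.mem_filter, decide_eq_true_eq] at h₁ h₂
    obtain ⟨-, rfl⟩ := h₁
    obtain ⟨-, rfl⟩ := h₂
    simp only [Prod.mk.injEq] at h ⊢
    tauto
  · have hp : ∀ p, p ∈ g.2.2.product h.2.2 ↔ p.1 ∈ g.2.2 ∧ p.2 ∈ h.2.2 := fun _ => List.mem_product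
    simp only [prodList, HostGraph.prod, List.mem_map, List.mem_filter, Finset.mem_image,
      Finset.mem_filter, decide_eq_true_eq, Finset.mem_product, hp, hg.2.2.2, hh.2.2.2]

/-! ### Simulation of a round on lists -/

section Round

variable {g : GuestList} {G : Guest Data Data} {H : HostGraph Data Data}
  {S T : HostGraph Data (Data × Data)}

/-- Two facts bridge the formulations: the members of a choice set of a node start in that node, by
`choice_union`, and edges of `T` project to edges of the host. -/
theorem edgeSupportedList_iff (hg : ListsGuest g G) (hT : T ≤ G.toHostGraph.prod H)
    {E : List ProdEdge} (hE : ∀ e, e ∈ E ↔ e ∈ T.edges) {e : ProdEdge} (he : e.1.1 ∈ G.nodes) :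
    edgeSupportedList g.2.2.2.2 E e = true ↔ EdgeSupported G H T e := by
  have hγ : ∀ γ ∈ G.choice e.1.1, ((∀ f ∈ γ, ∃ y ∈ E, (y.1, y.2.1, y.2.2.1) = (e.1, f.2.1, f.2.2)) ↔
      ∀ (b : Data) (x : Data), (e.1.1, b, x) ∈ γ →
      ∃ x' : Data, (e.1.2, b, x') ∈ H.out e.1.2 ∧ (e.1, b, (x, x')) ∈ T.out e.1) := by
    intro γ hγ
    constructor
    · intro h b x hb
      obtain ⟨⟨y₁, y₂, y₃, x'⟩, hy, hye⟩ := h _ hb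
      simp only [Prod.mk.injEq] at hye
      obtain ⟨rfl, rfl, rfl⟩ := hye
      have hy' := (hE _).1 hy
      exact ⟨x', HostGraph.mem_out.2 ⟨(HostGraph.mem_prod_edges.1 (hT.2.2 hy')).2, rfl⟩,
        HostGraph.mem_out.2 ⟨hy', rfl⟩⟩
    · rintro h ⟨u, b, x⟩ hf
      obtain rfl : u = e.1.1 := ((G.choice_union _ he _).1 ⟨γ, hγ, hf⟩).2
      obtain ⟨x', -, hx⟩ := h b x hf
      exact ⟨_, (hE _).2 (HostGraph.mem_out.1 hx).1, rfl⟩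
  simp only [edgeSupportedList, List.any_eq_true, Bool.and_eq_true, decide_eq_true_eq,
    List.all_eq_true, exists_eq_right]
  constructor
  · rintro ⟨c, hc, hce, l, hl, hel, h⟩
    obtain ⟨γ, hγc, hlγ⟩ := (hg.choice c hc).2 l hl
    rw [hce] at hγc
    exact ⟨γ, hγc, (hlγ _).1 hel, (hγ γ hγc).1 fun f hf => h f ((hlγ f).2 hf)⟩
  · rintro ⟨γ, hγc, heγ, h⟩
    obtain ⟨c, hc, hce⟩ := hg.exists_choice _ he
    obtain ⟨l, hl, hlγ⟩ := (hg.choice c hc).1 γ (hce ▸ hγc)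
    exact ⟨c, hc, hce, l, hl, (hlγ _).2 heγ, fun f hf => (hγ γ hγc).2 h f ((hlγ f).1 hf)⟩

theorem nodeRefutedList_iff (hg : ListsGuest g G) (hT : T ≤ G.toHostGraph.prod H)
    {E : List ProdEdge} (hE : ∀ e, e ∈ E ↔ e ∈ T.edges) {x : Data × Data}
    (hx : x.1 ∈ G.nodes) : nodeRefutedList g E x = true ↔ NodeRefuted G H T x := by
  have h₁ : T.out x = ∅ ↔ ∀ e ∈ E, ¬ e.1 = x := by
    simp only [Finset.eq_empty_iff_forall_notMem, HostGraph.mem_out, hE, not_and]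
  have h₂ : ∅ ∈ G.choice x.1 ↔ ∃ c ∈ g.2.2.2.2, c.1 = x.1 ∧ [] ∈ c.2 := by
    constructor
    · intro h
      obtain ⟨c, hc, hcx⟩ := hg.exists_choice _ hx
      obtain ⟨l, hl, hl'⟩ := (hg.choice c hc).1 ∅ (hcx ▸ h)
      obtain rfl : l = [] := List.eq_nil_iff_forall_not_mem.2 fun e he => by simpa using (hl' e).1 he
      exact ⟨c, hc, hcx, hl⟩
    · rintro ⟨c, hc, hcx, hl⟩
      obtain ⟨γ, hγ, hγ'⟩ := (hg.choice c hc).2 _ hl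
      obtain rfl : γ = ∅ := Finset.eq_empty_of_forall_notMem fun e he => by
        simpa using (hγ' e).2 he
      exact hcx ▸ hγ
  have h₃ : ∀ m, (∀ v' ∈ H.nodes, T.paths x (m, v') = ∅) ↔
      ∀ e ∈ reachEdges E x, ¬ e.2.2.1 = m := by
    intro m
    constructor
    · rintro h e he rfl
      have hp : (T.paths x e.2.2).Nonempty := (paths_nonempty_iff hE x e.2.2).2 ⟨e, he, rfl⟩
      -- The bound `v' ∈ H.nodes` is automatic for nodes reached inside the product.
      have hv : e.2.2.2 ∈ H.nodes := by
        obtain ⟨p, hp, -, -, ⟨f, hf, hfe⟩⟩ := hp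
        have := hT.2.1 (T.tgt_mem _ (hp f (List.mem_of_mem_getLast? hf)))
        rw [hfe] at this
        exact (Finset.mem_product.1 this).2
      exact hp.ne_empty (h _ hv)
    · intro h v' _
      by_contra hne
      obtain ⟨e, he, hev⟩ := (paths_nonempty_iff hE x (m, v')).1 (Set.nonempty_iff_ne_empty.2 hne)
      exact h e he (by rw [hev])
  have h₄ := fun m => paths_nonempty_iff hg.graph.2.2.2 x.1 m
  simp only [NodeRefuted, h₁, h₂, h₃, h₄, ← hg.must.2, nodeRefutedList, List.any_eq_true,
    Bool.and_eq_true, Bool.or_eq_true, decide_eq_true_eq, Bool.not_eq_true',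
    exists_eq_right, ← Bool.not_eq_true, not_exists, not_and]

/-- The enumeration that follows the order of a given list. -/
noncomputable def Enumeration.ofList {α : Type} [DecidableEq α] (l : List α) (hl : l.Nodup) :
    Enumeration α where
  -- An enumeration has to serve all finite sets, so elements outside `l` are appended in any order.
  toList s := (l.filter fun a => decide (a ∈ s)) ++ (s \ l.toFinset).toList
  nodup s := by
    refine List.Nodup.append (hl.filter _) (Finset.nodup_toList _) fun a ha ha' => ?_
    simp only [List.mem_filter] at ha
    simp [ha.1] at ha'
  mem_iff s a := by
    simp only [List.mem_append, List.mem_filter, decide_eq_true_eq, Finset.mem_toList,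
      Finset.mem_sdiff, List.mem_toFinset]
    tauto

theorem Enumeration.ofList_toList {α : Type} [DecidableEq α] {l : List α} (hl : l.Nodup)
    {s : Finset α} (hs : ∀ a ∈ s, a ∈ l) :
    (Enumeration.ofList l hl).toList s = l.filter fun a => decide (a ∈ s) := by
  have : s \ l.toFinset = ∅ := by
    rw [Finset.sdiff_eq_empty_iff_subset]
    exact fun a ha => List.mem_toFinset.2 (hs a ha)
  simp [Enumeration.ofList, this]

/-- `F` consists of the elements of `s`, in the order of `l`. -/
def ListsAlong {α : Type} [DecidableEq α] (l F : List α) (s : Finset α) : Prop :=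
  F = l.filter fun a => decide (a ∈ s)

theorem ListsAlong.mem_iff {α : Type} [DecidableEq α] {l F : List α} {s t : Finset α}
    (h : ListsAlong l F s) (hl : Lists l t) (hst : s ⊆ t) (a : α) : a ∈ F ↔ a ∈ s := by
  rw [h, List.mem_filter, hl.2, decide_eq_true_eq]
  exact ⟨fun h => h.2, fun h => ⟨hst h, h⟩⟩

theorem ListsAlong.filter {α : Type} [DecidableEq α] {l F : List α} {s s' : Finset α}
    {p : α → Bool} (h : ListsAlong l F s) (hp : ∀ a, a ∈ s' ↔ a ∈ s ∧ p a = true) :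
    ListsAlong l (F.filter p) s' := by
  rw [ListsAlong, h, List.filter_filter]
  refine List.filter_congr fun a _ => ?_
  rw [Bool.eq_iff_iff]
  simp only [Bool.and_eq_true, decide_eq_true_eq, hp]
  tauto

variable {V : List (Data × Data)} {E : List ProdEdge}

/-- The program deletes without reordering, so its current list is always the initial list `E`
filtered. Hence a single enumeration, read off from `E`, describes the order of the inner loop at
all nodes and times of the round. -/
theorem listsAlong_pruneEdgesList (hg : ListsGuest g G) (hS : S ≤ G.toHostGraph.prod H)
    (hE : Lists E S.edges) {F : List ProdEdge} (hF : ListsAlong E F T.edges) (hT : T ≤ S)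
    (x : Data × Data) :
    ListsAlong E (pruneEdgesList g.2.2.2.2 F x)
      (pruneEdges G H (Enumeration.ofList E hE.1) T x).edges := by
  have hord : (Enumeration.ofList E hE.1).toList (T.out x) =
      F.filter fun e => decide (e.1 = x) := by
    rw [Enumeration.ofList_toList hE.1 fun e he =>
      (hE.2 e).2 (hT.2.2 (HostGraph.mem_out.1 he).1)]
    exact (hF.filter fun e => by simp [HostGraph.mem_out]).symm
  have hsrc : ∀ e ∈ F.filter fun e => decide (e.1 = x), e.1.1 ∈ G.nodes := by
    intro e he
    have he := (hF.mem_iff hE hT.2.2 e).1 (List.mem_filter.1 he).1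
    exact (Finset.mem_product.1 (hS.2.1 (hT.2.1 (T.src_mem e he)))).1
  unfold pruneEdges pruneEdgesList
  rw [hord]
  refine (List.foldl_rel (r := fun (F : List ProdEdge) (T : HostGraph Data (Data × Data)) =>
    ListsAlong E F T.edges ∧ T ≤ S) ⟨hF, hT⟩ fun e he F T hFT => ?_).1
  have hiff := edgeSupportedList_iff hg (HostGraph.le_trans hFT.2 hS)
    (hFT.1.mem_iff hE hFT.2.2.2) (hsrc e he)
  by_cases hsup : EdgeSupported G H T e
  · rw [if_pos hsup, hiff.2 hsup]
    exact hFT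
  · rw [if_neg hsup, Bool.eq_false_iff.2 (mt hiff.1 hsup)]
    refine ⟨hFT.1.filter fun f => ?_, HostGraph.le_trans (T.removeEdge_le e) hFT.2⟩
    simp [HostGraph.removeEdge, and_comm]

/-- The orders are those of the given lists, so they depend on the representation and may change
between rounds; this is the reason for the freedom in `PruneRounds`. -/
theorem lists_pruneRoundList (hg : ListsGuest g G) (hS : S ≤ G.toHostGraph.prod H)
    (hV : Lists V S.nodes) (hE : Lists E S.edges) :
    ∃ ordV ordE, Lists (pruneRoundList g (V, E)).1 (pruneRound G H ordV ordE S).nodes ∧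
      Lists (pruneRoundList g (V, E)).2 (pruneRound G H ordV ordE S).edges := by
  let ordV := Enumeration.ofList V hV.1
  let ordE := Enumeration.ofList E hE.1
  have hself : ∀ {α : Type} [DecidableEq α] {l : List α} {s : Finset α}, Lists l s →
      ListsAlong l l s := fun hl =>
    (List.filter_eq_self.2 fun a ha => decide_eq_true ((hl.2 a).1 ha)).symm
  have hord : ordV.toList S.nodes = V :=
    (Enumeration.ofList_toList hV.1 fun a ha => (hV.2 a).2 ha).trans (hself hV).symm
  have key : ListsAlong V (pruneRoundList g (V, E)).1 (pruneRound G H ordV ordE S).nodes ∧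
      ListsAlong E (pruneRoundList g (V, E)).2 (pruneRound G H ordV ordE S).edges ∧
      pruneRound G H ordV ordE S ≤ S := by
    unfold pruneRound pruneRoundList
    rw [hord]
    refine List.foldl_rel (r := fun (F : List (Data × Data) × List ProdEdge)
      (T : HostGraph Data (Data × Data)) => ListsAlong V F.1 T.nodes ∧ ListsAlong E F.2 T.edges ∧
        T ≤ S) ⟨hself hV, hself hE, S.le_refl⟩ ?_
    rintro x hx ⟨A, B⟩ T ⟨hA, hB, hT⟩
    have hB' : ListsAlong E (pruneEdgesList g.2.2.2.2 B x) (pruneEdges G H ordE T x).edges :=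
      listsAlong_pruneEdgesList hg hS hE hB hT x
    have hT' : pruneEdges G H ordE T x ≤ S := HostGraph.le_trans (pruneEdges_le ordE T x) hT
    have hA' : ListsAlong V A (pruneEdges G H ordE T x).nodes := by
      have : (pruneEdges G H ordE T x).nodes = T.nodes :=
        foldl_invariant (p := fun R : HostGraph Data (Data × Data) => R.nodes = T.nodes)
          (fun R e h => by split_ifs <;> exact h) _ rfl
      rwa [this]
    have hiff := nodeRefutedList_iff hg (HostGraph.le_trans hT' hS) (hB'.mem_iff hE hT'.2.2)
      (Finset.mem_product.1 (hS.2.1 ((hV.2 x).1 hx))).1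
    unfold pruneNode pruneNodeList
    by_cases hr : NodeRefuted G H (pruneEdges G H ordE T x) x
    · rw [if_pos hr, hiff.2 hr]
      refine ⟨hA'.filter fun y => ?_, hB'.filter fun e => ?_,
        HostGraph.le_trans (HostGraph.removeNode_le _ x) hT'⟩
      · simp [HostGraph.removeNode, and_comm]
      · simp [HostGraph.removeNode]
    · rw [if_neg hr, Bool.eq_false_iff.2 (mt hiff.1 hr)]
      exact ⟨hA', hB', hT'⟩
  obtain ⟨h₁, h₂, h₃⟩ := key
  refine ⟨ordV, ordE, ⟨?_, h₁.mem_iff hV h₃.2.1⟩, ⟨?_, h₂.mem_iff hE h₃.2.2⟩⟩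
  · rw [h₁]
    exact hV.1.filter _
  · rw [h₂]
    exact hE.1.filter _

end Round

/-! ### Polynomial-time solvability -/

theorem exists_lists_of_isFragmentInput {i : Guest Data Data × HostGraph Data Data} {d : Data}
    (h : IsFragmentInput i d) : ∃ j : GuestList × GraphList Data,
      ListsGuest j.1 i.1 ∧ ListsGraph j.2 i.2 ∧ d = enc j := by
  obtain ⟨-, -, _, _, rfl, hG, hH⟩ := h
  obtain ⟨g, hg, rfl⟩ := exists_listsGuest hG
  obtain ⟨k, hk, rfl⟩ := isGraphCode_enc_iff.1 hH
  exact ⟨(g, k), hg, hk, rfl⟩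

/-- A function on encoded data that maps the codes of instances to correct outputs solves the
problem. -/
theorem Poly.polyTimeSolvable {ι : Type*} {α β : Type} [Enc α] [Enc β] {f : α → β} (hf : Poly f)
    {input output : ι → Data → Prop}
    (h : ∀ i x, input i x → ∃ a, x = enc a ∧ output i (enc (f a))) :
    PolyTimeSolvable input output := by
  obtain ⟨P, p, hP⟩ := hf
  refine ⟨P, p, fun i x hx => ?_⟩
  obtain ⟨a, rfl, ha⟩ := h i x hx
  obtain ⟨t, ht, htp⟩ := hP a
  exact ⟨t, _, ht, htp, ha⟩

theorem polyTimeSolvable_pruneRound : PolyTimeSolvable IsRoundInput (fun i y =>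
    ∃ ordV ordE, IsResultCode (some (pruneRound i.1.1 i.1.2 ordV ordE i.2)) y) := by
  have hf : Poly fun j : (GuestList × GraphList Data) × GraphList (Data × Data) =>
      (j.2.1, pruneRoundList j.1.1 j.2.2) := by fun_prop
  refine hf.polyTimeSolvable ?_
  rintro ⟨⟨G, H⟩, S⟩ _ ⟨hS, _, _, rfl, hI, hSc⟩
  obtain ⟨j, hG, -, rfl⟩ := exists_lists_of_isFragmentInput hI
  obtain ⟨s, hs, rfl⟩ := isGraphCode_enc_iff.1 hSc
  obtain ⟨ordV, ordE, hV, hE⟩ := lists_pruneRoundList hG hS hs.2.1 hs.2.2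
  refine ⟨(j, s), rfl, ordV, ordE, isGraphCode_enc_iff.2 ⟨_, ⟨?_, hV, hE⟩, rfl⟩⟩
  rw [pruneRound_symbols]
  exact hs.1

/-! ### The result of the list algorithm -/

section Result

variable {j : GuestList × GraphList Data} {G : Guest Data Data} {H : HostGraph Data Data}

theorem exists_pruneRounds_foldl {α : Type} (hg : ListsGuest j.1 G) {k : ℕ}
    {S : HostGraph Data (Data × Data)} (hS : PruneRounds G H (G.toHostGraph.prod H) k S)
    {F : List (Data × Data) × List ProdEdge} (hV : Lists F.1 S.nodes) (hE : Lists F.2 S.edges)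
    (l : List α) :
    ∃ T, PruneRounds G H (G.toHostGraph.prod H) (k + l.length) T ∧
      Lists (l.foldl (fun F _ => pruneRoundList j.1 F) F).1 T.nodes ∧
      Lists (l.foldl (fun F _ => pruneRoundList j.1 F) F).2 T.edges := by
  induction l generalizing k S F with
  | nil => exact ⟨S, hS, hV, hE⟩
  | cons a l ih =>
    obtain ⟨ordV, ordE, hV', hE'⟩ := lists_pruneRoundList hg
      (hS.isUpperApprox (isUpperApprox_prod G H)).le_prod hV hE
    obtain ⟨T, hT, h⟩ := ih (hS.succ ordV ordE) hV' hE'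
    exact ⟨T, by rwa [List.length_cons, Nat.add_comm l.length, ← Nat.add_assoc], h⟩

theorem exists_lists_pruneList (hg : ListsGuest j.1 G) (hh : ListsGraph j.2 H) :
    ∃ T, IsUpperApprox G H T ∧ IsStable G H T ∧
      ListsGraph ((prodList j.1.1 j.2).1, pruneList j) T := by
  have hp := listsGraph_prodList hg.graph hh
  obtain ⟨S, hS, hSV, hSE⟩ := exists_pruneRounds_foldl hg
    (PruneRounds.zero (G := G) (H := H)) hp.2.1 hp.2.2 (prodList j.1.1 j.2).2.1
  obtain ⟨T, hT, hTV, hTE⟩ := exists_pruneRounds_foldl hg hS hSV hSE (prodList j.1.1 j.2).2.2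
  have hup := hT.isUpperApprox (isUpperApprox_prod G H)
  refine ⟨T, hup, hT.isStable ?_, ?_, hTV, hTE⟩
  -- The two counters have lengths `|V|` and `|E|`, which add up to the `card` of the product.
  · rw [hp.2.1.length_eq, hp.2.2.length_eq, Nat.zero_add]
    exact le_rfl
  · rw [hup.symbols_eq]
    exact hp.1

theorem exists_isResultCode_pruneReturnList (hU : G.unique = ∅) (hI : G.exclusive = ∅)
    (hg : ListsGuest j.1 G) (hh : ListsGraph j.2 H) :
    ∃ r, IsResultCode r (pruneReturnList j) ∧ IsPruningResult G H r := by
  obtain ⟨T, hup, hst, hT⟩ := exists_lists_pruneList hg hh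
  refine ⟨_, ?_, isPruningResult_pruneReturn hU hI hup hst⟩
  have hiff : (j.1.2.1.all fun m => (pruneList j).1.any fun x => decide (x.1 = m)) = true ↔
      ∀ m ∈ G.must, ∃ v ∈ H.nodes, (m, v) ∈ T.nodes := by
    simp only [List.all_eq_true, List.any_eq_true, decide_eq_true_eq, hg.must.2, hT.2.1.2]
    refine forall₂_congr fun m _ => ⟨?_, ?_⟩
    · rintro ⟨⟨u, v⟩, hx, rfl⟩
      exact ⟨v, (Finset.mem_product.1 (hup.le_prod.2.1 hx)).2, hx⟩
    · rintro ⟨v, -, hv⟩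
      exact ⟨_, hv, rfl⟩
  unfold pruneReturn pruneReturnList
  by_cases h : ∀ m ∈ G.must, ∃ v ∈ H.nodes, (m, v) ∈ T.nodes
  · rw [if_pos h, hiff.2 h]
    exact isGraphCode_enc_iff.2 ⟨_, hT, rfl⟩
  · rw [if_neg h, Bool.eq_false_iff.2 (mt hiff.1 h)]
    rfl

end Result

theorem polyTimeSolvable_result : PolyTimeSolvable IsFragmentInput (fun i y =>
    ∃ r, IsResultCode r y ∧ (∀ ordV ordE, ∃ n, PruningRun i.1 i.2 ordV ordE n r) ∧
      (∀ S, r = some S ↔ IsGreatest (LGS i.1 i.2) S) ∧ (r = none ↔ LGS i.1 i.2 = ∅)) := by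
  refine Poly.pruneReturnList.polyTimeSolvable ?_
  rintro ⟨G, H⟩ x hx
  obtain ⟨j, hG, hH, rfl⟩ := exists_lists_of_isFragmentInput hx
  obtain ⟨r, hr, h⟩ := exists_isResultCode_pruneReturnList hx.1 hx.2.1 hG hH
  exact ⟨j, rfl, r, hr, fun ordV ordE => h.exists_pruningRun hx.1 hx.2.1 ordV ordE, h⟩

theorem isResultCode_nil_iff {r : Option (HostGraph Data (Data × Data))} {d : Data}
    (h : IsResultCode r d) : d = .nil ↔ r = none := by
  cases r with
  | none => exact ⟨fun _ => rfl, fun _ => h⟩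
  | some S =>
    obtain ⟨_, _, _, rfl, -⟩ := h
    simp

/-- Emptiness is read off from the computed result by a comparison with `nil`. -/
theorem polyTimeSolvable_emptiness : PolyTimeSolvable IsFragmentInput (fun i y =>
    (LGS i.1 i.2 = ∅ ∧ y = Data.tt) ∨ (LGS i.1 i.2 ≠ ∅ ∧ y = Data.nil)) := by
  refine (Poly.decide_eq Poly.pruneReturnList (Poly.const Data.nil)).polyTimeSolvable ?_
  rintro ⟨G, H⟩ x hx
  obtain ⟨j, hG, hH, rfl⟩ := exists_lists_of_isFragmentInput hx
  obtain ⟨r, hr, h⟩ := exists_isResultCode_pruneReturnList hx.1 hx.2.1 hG hH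
  have hiff := (isResultCode_nil_iff hr).trans h.2
  refine ⟨j, rfl, ?_⟩
  by_cases he : LGS G H = ∅
  · exact Or.inl ⟨he, by rw [decide_eq_true (hiff.2 he)]; rfl⟩
  · exact Or.inr ⟨he, by rw [decide_eq_false (mt hiff.1 he)]; rfl⟩

end LooseSim

theorem mainTheorem2 :
    -- the greatest loose graph simulation exists as soon as there is any, and the pruning
    -- algorithm halts and returns it, or "false" if there is none
    (∀ {L : Type*} {N : Type*} {N' : Type*} [DecidableEq L] [DecidableEq N] [DecidableEq N']
      (G : Guest L N) (H : HostGraph L N'), G.unique = ∅ → G.exclusive = ∅ →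
      ((LGS G H).Nonempty → ∃ S, IsGreatest (LGS G H) S) ∧
      ∀ (ordV : Enumeration (N × N')) (ordE : Enumeration ((N × N') × L × (N × N'))),
        ∃ (n : ℕ) (r : Option (HostGraph L (N × N'))), PruningRun G H ordV ordE n r ∧
          n ≤ (G.toHostGraph.prod H).nodes.card + (G.toHostGraph.prod H).edges.card + 1 ∧
          (∀ S, r = some S ↔ IsGreatest (LGS G H) S) ∧
          (r = none ↔ LGS G H = ∅)) ∧
    -- one round of the algorithm (for some order of its inner loops) takes polynomial time
    PolyTimeSolvable IsRoundInput (fun i y =>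
      ∃ ordV ordE, IsResultCode (some (pruneRound i.1.1 i.1.2 ordV ordE i.2)) y) ∧
    -- the result of the algorithm, the greatest loose graph simulation or "false", is computed
    -- in polynomial time
    PolyTimeSolvable IsFragmentInput (fun i y =>
      ∃ r, IsResultCode r y ∧ (∀ ordV ordE, ∃ n, PruningRun i.1 i.2 ordV ordE n r) ∧
        (∀ S, r = some S ↔ IsGreatest (LGS i.1 i.2) S) ∧ (r = none ↔ LGS i.1 i.2 = ∅)) ∧
    -- the emptiness problem is decided in polynomial time
    PolyTimeSolvable IsFragmentInput (fun i y =>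
      (LGS i.1 i.2 = ∅ ∧ y = Data.tt) ∨ (LGS i.1 i.2 ≠ ∅ ∧ y = Data.nil)) := by
  refine ⟨fun G H hU hI => ⟨exists_isGreatest_of_nonempty hU hI, fun ordV ordE => ?_⟩,
    polyTimeSolvable_pruneRound, polyTimeSolvable_result, polyTimeSolvable_emptiness⟩
  obtain ⟨n, r, hr, hn, h⟩ := exists_pruningRun (H := H) hU hI ordV ordE
  exact ⟨n, r, hr, hn, h⟩
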